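/- Let $\mathcal H$ be a complex Hilbert space, $H_0\ge 0$ a self-adjoint operator in $\mathcal H$ with domain $\mathcal D(H_0)$, and let $V_t$, $t\in\mathbb R$, be linear operators defined on $\mathcal D(H_0)$ such that $H(t)=H_0+V_t$ is self-adjoint on $\mathcal D(H_0)$ for every $t\in\mathbb R$. Suppose that $V_t$ is uniformly Kato-bounded, i.e. there are constants $a<1$ and $b<\infty$ with $$\|V_t\Psi\|\le a\,\|H_0\Psi\|+b\,\|\Psi\|\qquad\text{for all }\Psi\in\mathcal D(H_0),\ t\in\mathbb R,$$ and that $t\mapsto V_t\Psi$ is differentiable in norm for every $\Psi\in\mathcal D(H_0)$, with derivatives $\partial_tV_t\Psi$ such that $\sup_{t\in\mathbb R}\|\partial_tV_t\|<\infty$. Let $U(t,s)$, $s,t\in\mathbb R$, be a unitary propagator (unitary operators, jointly strongly continuous in $(t,s)$, with $U(t,s)U(s,r)=U(t,r)$ and $U(s,s)=I$) generated by $H(t)$: $U(t,s)\mathcal D(H_0)\subseteq\mathcal D(H_0)$ and $$i\frac{d}{dt}U(t,s)\Psi=H(t)U(t,s)\Psi\qquad\text{for all }\Psi\in\mathcal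 D(H_0),\ s,t\in\mathbb R.$$ Let $\mathcal D_0\subseteq\mathcal D(H_0)$ be a total set in $\mathcal H$ (its linear span is dense) such that for every $\Phi\in\mathcal D_0$ there is $h\in L^1(\mathbb R)$ with, for all $t\in\mathbb R$, $$\|V_te^{-iH_0t}\Phi\|\le\frac{h(t)}{1+|t|},\qquad \|\partial_tV_t\,e^{-iH_0t}\Phi\|\le h(t).$$ Then the wave operators $$\Omega^\pm=\operatorname*{s-lim}_{t\to\pm\infty}U(t,0)^*e^{-iH_0t}$$ exist as bounded operators on $\mathcal H$, and for each of the two signs: 1. the closed linear span of $\Omega^\pm\mathcal D_0$ is $\operatorname{Ran}\Omega^\pm$, and for every $\Psi\in\Omega^\pm\mathcal D_0$ one has $U(t,0)\Psi\in\mathcal D(H_0^{1/2})$ for all $t$ with $\pm t\ge0$, and $$\sup_{\pm t\ge0}\|H_0^{1/2}U(t,0)\Psi\|<\infty;$$ 2. for every $\Psi\in\operatorname{Ran}\Omega^\pm$ and every $\epsilon>0$ there is a cutoff energy $E=E(\epsilon,\Psi)$ such that $$\sup_{\pm t\ge0}\|F(H_0>E)\,U(t,0)\Psi\|<\epsilon,$$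 where $F(H_0>E)$ is the spectral projection of $H_0$ onto $(E,\infty)$. -/

import Mathlib

open Filter Topology MeasureTheory Set
open scoped InnerProductSpace

noncomputable section

namespace TimeDependentScattering

variable {H : Type*} [NormedAddCommGroup H] [InnerProductSpace ℂ H] [CompleteSpace H]

/-! ### Functions of a self-adjoint operator -/

/-- A family `W t` of bounded operators is the strongly continuous one-parameter unitary group
`exp (-i t A)`: its infinitesimal generator is exactly `A`, i.e. `x` is in the domain of `A` with
`A x = y` if and only if `t ↦ W t x` has the derivative `-i y` at `t = 0`. -/
structure IsUnitaryGroupOf (A : H →ₗ.[ℂ] H) (W : ℝ → H →L[ℂ] H) : Prop where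
  unitary : ∀ t, W t ∈ unitary (H →L[ℂ] H)
  add : ∀ s t, W (s + t) = W s * W t
  continuous : ∀ x, Continuous fun t => W t x
  generator : ∀ x y : H,
    (x, y) ∈ A.graph ↔ HasDerivAt (fun t : ℝ => W t x) (-(Complex.I • y)) 0

open Classical in
/-- The unitary group `exp (-i t A)` of a self-adjoint operator `A` (junk value `1` if there is
none; for self-adjoint `A` it exists and is unique by Stone's theorem). -/
def expGroup (A : H →ₗ.[ℂ] H) : ℝ → H →L[ℂ] H :=
  if h : ∃ W, IsUnitaryGroupOf A W then h.choose else fun _ => 1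

/-- The operator `A` is non-negative: `⟪x, A x⟫ ≥ 0` for all `x` in its domain. -/
def IsNonneg (A : H →ₗ.[ℂ] H) : Prop :=
  ∀ x : A.domain, 0 ≤ (⟪(x : H), A x⟫_ℂ).re

/-- `B` is the non-negative self-adjoint square root of `A`: `B ∘ B = A`, including domains. -/
structure IsSqrtOf (A B : H →ₗ.[ℂ] H) : Prop where
  selfAdjoint : IsSelfAdjoint B
  nonneg : IsNonneg B
  sq : ∀ x y : H, (x, y) ∈ A.graph ↔ ∃ z, (x, z) ∈ B.graph ∧ (z, y) ∈ B.graph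

open Classical in
/-- The square root `A ^ (1/2)` of a non-negative self-adjoint operator (junk value `A` if there
is none; for non-negative self-adjoint `A` it exists and is unique). -/
def sqrtOp (A : H →ₗ.[ℂ] H) : H →ₗ.[ℂ] H :=
  if h : ∃ B, IsSqrtOf A B then h.choose else A

variable (H) in
/-- A projection-valued measure on the Borel sets of `ℝ`. The values of `proj` on sets which are
not Borel are irrelevant. -/
structure ProjectionValuedMeasure where
  proj : Set ℝ → H →L[ℂ] H
  isStarProjection : ∀ S, MeasurableSet S → IsStarProjection (proj S)
  empty : proj ∅ = 0
  univ : proj Set.univ = 1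
  inter : ∀ S T, MeasurableSet S → MeasurableSet T → proj (S ∩ T) = proj S * proj T
  iUnion : ∀ S : ℕ → Set ℝ, (∀ n, MeasurableSet (S n)) → Pairwise (Function.onFun Disjoint S) →
    ∀ x, HasSum (fun n => proj (S n) x) (proj (⋃ n, S n) x)

/-- `⟪x, E(S) x⟫ ≥ 0` for a projection-valued measure `E`. -/
theorem ProjectionValuedMeasure.re_inner_nonneg (E : ProjectionValuedMeasure H) (x : H)
    {S : Set ℝ} (hS : MeasurableSet S) : 0 ≤ (⟪x, E.proj S x⟫_ℂ).re := by
  have hP := E.isStarProjection S hS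
  have h1 : E.proj S x = E.proj S (E.proj S x) := by
    conv_lhs => rw [← hP.isIdempotentElem.eq]
    rfl
  have h2 : ⟪x, E.proj S (E.proj S x)⟫_ℂ = ⟪E.proj S x, E.proj S x⟫_ℂ := by
    rw [← ContinuousLinearMap.adjoint_inner_left, ← ContinuousLinearMap.star_eq_adjoint,
      hP.isSelfAdjoint.star_eq]
  rw [h1, h2]
  exact inner_self_nonneg (𝕜 := ℂ)

/-- The scalar measure `S ↦ ⟪x, E(S) x⟫` of a vector `x`. -/
def ProjectionValuedMeasure.scalarMeasure (E : ProjectionValuedMeasure H) (x : H) : Measure ℝ :=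
  Measure.ofMeasurable (fun S _ => ENNReal.ofReal (⟪x, E.proj S x⟫_ℂ).re)
    (by simp [E.empty])
    (by
      intro S hS hd
      have h := ((E.iUnion S hS hd x).mapL (innerSL ℂ x)).mapL Complex.reCLM
      simp only [innerSL_apply_apply, Complex.reCLM_apply] at h
      rw [← h.tsum_eq]
      exact ENNReal.ofReal_tsum_of_nonneg (fun n => E.re_inner_nonneg x (hS n)) h.summable)

/-- `E` is the spectral measure of `A`, i.e. `A = ∫ λ dE(λ)`: a vector `x` is in the domain of `A`
if and only if `∫ λ² d⟪x, E(λ) x⟫ < ∞`, and then `⟪x, A x⟫ = ∫ λ d⟪x, E(λ) x⟫`. -/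
structure ProjectionValuedMeasure.IsSpectralMeasureOf (E : ProjectionValuedMeasure H)
    (A : H →ₗ.[ℂ] H) : Prop where
  mem_domain : ∀ x : H,
    x ∈ A.domain ↔ ∫⁻ r, ENNReal.ofReal (r ^ 2) ∂(E.scalarMeasure x) < ⊤
  inner_apply : ∀ x : A.domain,
    ⟪(x : H), A x⟫_ℂ = ((∫ r, r ∂(E.scalarMeasure (x : H)) : ℝ) : ℂ)

open Classical in
/-- The spectral projection `F(A ∈ S)` of a self-adjoint operator `A` and a Borel set `S` (junk
value `0` if there is no spectral measure; for self-adjoint `A` it exists and is unique by the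
spectral theorem). -/
def spectralProjection (A : H →ₗ.[ℂ] H) (S : Set ℝ) : H →L[ℂ] H :=
  if h : ∃ E : ProjectionValuedMeasure H, E.IsSpectralMeasureOf A then h.choose.proj S else 0

/-! ### Time-dependent perturbations -/

/-- `H(t) = H₀ + V_t` on the domain of `H₀`. -/
def hamiltonian (H₀ : H →ₗ.[ℂ] H) (V : ℝ → H₀.domain →ₗ[ℂ] H) (t : ℝ) : H →ₗ.[ℂ] H where
  domain := H₀.domain
  toFun := H₀.toFun + V t

/-- `V_t` is Kato-bounded with respect to `H₀`, uniformly in `t`. -/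
def UniformlyKatoBounded (H₀ : H →ₗ.[ℂ] H) (V : ℝ → H₀.domain →ₗ[ℂ] H) : Prop :=
  ∃ a b : ℝ, a < 1 ∧ ∀ (t : ℝ) (x : H₀.domain), ‖V t x‖ ≤ a * ‖H₀ x‖ + b * ‖(x : H)‖

/-- The time derivative `(∂_t V_t) x`, for `x` in the domain of `H₀`. -/
def timeDeriv {H₀ : H →ₗ.[ℂ] H} (V : ℝ → H₀.domain →ₗ[ℂ] H) (t : ℝ) (x : H₀.domain) : H :=
  deriv (fun s => V s x) t

/-- `∂_t V_t` exists (strongly on the domain of `H₀`), and the operators `∂_t V_t` are bounded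
with `sup_t ‖∂_t V_t‖ < ∞`. -/
def HasBoundedTimeDeriv {H₀ : H →ₗ.[ℂ] H} (V : ℝ → H₀.domain →ₗ[ℂ] H) : Prop :=
  (∀ x : H₀.domain, Differentiable ℝ fun t => V t x) ∧
    ∃ M : ℝ, ∀ (t : ℝ) (x : H₀.domain), ‖timeDeriv V t x‖ ≤ M * ‖(x : H)‖

/-- A unitary propagator. -/
structure IsUnitaryPropagator (U : ℝ → ℝ → H →L[ℂ] H) : Prop where
  unitary : ∀ t s, U t s ∈ unitary (H →L[ℂ] H)
  self : ∀ s, U s s = 1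
  mul : ∀ t s r, U t s * U s r = U t r
  continuous : ∀ x, Continuous fun p : ℝ × ℝ => U p.1 p.2 x

/-- The propagator `U` leaves the domain of `H₀` invariant, and there it solves
`i (d/dt) U(t,s) x = H(t) U(t,s) x`. -/
def IsGeneratedBy (H₀ : H →ₗ.[ℂ] H) (V : ℝ → H₀.domain →ₗ[ℂ] H) (U : ℝ → ℝ → H →L[ℂ] H) : Prop :=
  ∀ (t s : ℝ) (x : H₀.domain), ∃ hx : U t s x ∈ H₀.domain,
    HasDerivAt (fun r : ℝ => U r s x)
      (-(Complex.I • hamiltonian H₀ V t ⟨U t s x, hx⟩)) t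

/-- `Ω = s-lim U(t,0)^* exp (-i H₀ t)` along the filter `l` (`t → ∞` or `t → -∞`). -/
def IsWaveOperator (H₀ : H →ₗ.[ℂ] H) (U : ℝ → ℝ → H →L[ℂ] H) (l : Filter ℝ)
    (Ω : H →L[ℂ] H) : Prop :=
  ∀ x : H, Tendsto (fun t => ContinuousLinearMap.adjoint (U t 0) (expGroup H₀ t x)) l (𝓝 (Ω x))

/-- `sup_{t ∈ J} ‖H₀^{1/2} U(t,0) x‖ < ∞`; this includes that `U(t,0) x` is in the domain of
`H₀^{1/2}` for all `t ∈ J`. -/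
def KineticEnergyBounded (H₀ : H →ₗ.[ℂ] H) (U : ℝ → ℝ → H →L[ℂ] H) (J : Set ℝ) (x : H) : Prop :=
  ∃ C : ℝ, ∀ t ∈ J, ∃ hx : U t 0 x ∈ (sqrtOp H₀).domain, ‖sqrtOp H₀ ⟨U t 0 x, hx⟩‖ ≤ C

/-- For every `ε > 0` there is a cutoff energy `E` with
`sup_{t ∈ J} ‖F(H₀ > E) U(t,0) x‖ < ε`. -/
def HighEnergyUniformlySmall (H₀ : H →ₗ.[ℂ] H) (U : ℝ → ℝ → H →L[ℂ] H) (J : Set ℝ)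
    (x : H) : Prop :=
  ∀ ε > (0 : ℝ), ∃ E : ℝ, ∃ c < ε, ∀ t ∈ J, ‖spectralProjection H₀ (Ioi E) (U t 0 x)‖ ≤ c

end TimeDependentScattering

end

noncomputable section

namespace TimeDependentScattering

set_option linter.unusedSectionVars false

variable {H : Type*} [NormedAddCommGroup H] [InnerProductSpace ℂ H] [CompleteSpace H]

/-! ### Self-adjoint operators and resolvents -/

section SelfAdjoint

variable {A : H →ₗ.[ℂ] H}

/-! Fix `x ∈ D₀` and, for each `T`, let `ψ(t) = U(t,T) e^{-iH₀T} x` be the true evolution that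
agrees with the free one at time `T`. Cook's estimate (`norm_sub_le_integral_of_decay`) bounds
`‖ψ(t) - e^{-iH₀t} x‖` by the integral of `h(r)/(1+|r|)` between `t` and `T`. This gives convergence
to the wave operators on `D₀`, hence everywhere because the approximants are isometries. For `t`
between `0` and `T` it also gives the rate `‖h‖₁/(1+|t|)`.

The rate controls the energy. By `IsSolution.hasDerivAt_energy`, `⟪ψ, H(t) ψ⟫` has derivative `⟪ψ,
(∂_t V_t) ψ⟫`. Write `ψ = e^{-iH₀t} x + δ`. Terms in which `∂_t V_t` hits the free evolution are at
most `3‖x‖ h(t)`, and the remaining one is at most `M‖δ‖² ≤ M‖h‖₁²/(1+|t|)²`. Both are integrable,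
so the energy at `t` differs from that at `T` by a constant independent of `T`. The weight
`1/(1+|t|)` in the hypothesis serves to make the quadratic term integrable. At time `T` the kinetic
energy is `⟪x, H₀ x⟫`, and the Kato bound implies a form bound with relative constant below `1`
(`UniformlyKatoBounded.exists_form_bound`), so total energy controls kinetic energy: this is
`exists_kinetic_energy_bound`. Letting `T → ±∞` with `t` fixed, `ψ(t) → U(t,0) Ω x`, and the bound
passes to the limit because `H₀^{1/2}` is closed. Chebyshev's inequality for the spectral measure
then gives uniform smallness at high energy on `Ω D₀`; linearity, density and isometry extend it to
`Ran Ω`.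

The unitary group, the square root and the spectral measure of `H₀` are chosen objects with default
values, so their existence is part of the proof. All three come from the bounded resolvent `R =
(H₀+1)⁻¹`, whose spectrum lies in `[0,1]`: under `λ = r⁻¹ - 1` functions of `H₀` become functions of
`R`. -/

theorem inner_apply_left_of_isSelfAdjoint (hA : IsSelfAdjoint A) (x y : A.domain) :
    ⟪A x, (y : H)⟫_ℂ = ⟪(x : H), A y⟫_ℂ := by
  have h := LinearPMap.adjoint_isFormalAdjoint hA.dense_domain
  rw [LinearPMap.isSelfAdjoint_def.1 hA] at h
  exact h x y

/-- The inclusion `A* ⊆ A`. It is the form in which maximality of a self-adjoint operator is used: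
it yields closedness, surjectivity of `A + μ`, and the exact domain of the generator. -/
theorem exists_apply_eq_of_forall_inner (hA : IsSelfAdjoint A) {x y : H}
    (h : ∀ z : A.domain, ⟪A z, x⟫_ℂ = ⟪(z : H), y⟫_ℂ) :
    ∃ hx : x ∈ A.domain, A ⟨x, hx⟩ = y := by
  have h' : ∀ z : A.domain, ⟪y, (z : H)⟫_ℂ = ⟪x, A z⟫_ℂ := fun z => by
    rw [← inner_conj_symm, ← h z, inner_conj_symm]
  have hx : x ∈ A.adjoint.domain := LinearPMap.mem_adjoint_domain_of_exists x ⟨y, h'⟩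
  have h2 := LinearPMap.adjoint_apply_eq hA.dense_domain ⟨x, hx⟩ h'
  have h3 : (x, y) ∈ A.adjoint.graph := (LinearPMap.mem_graph_iff _).2 ⟨⟨x, hx⟩, rfl, h2⟩
  rw [LinearPMap.isSelfAdjoint_def.1 hA] at h3
  obtain ⟨⟨x', hx'⟩, rfl, h4⟩ := (LinearPMap.mem_graph_iff _).1 h3
  exact ⟨hx', h4⟩

theorem mem_graph_iff_exists {x y : H} :
    (x, y) ∈ A.graph ↔ ∃ hx : x ∈ A.domain, A ⟨x, hx⟩ = y := by
  rw [LinearPMap.mem_graph_iff]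
  constructor
  · rintro ⟨⟨x', hx'⟩, rfl, h4⟩
    exact ⟨hx', h4⟩
  · rintro ⟨hx, h⟩
    exact ⟨⟨x, hx⟩, rfl, h⟩

theorem inner_self_apply_eq_re (hA : IsSelfAdjoint A) (x : A.domain) :
    ⟪(x : H), A x⟫_ℂ = ((⟪(x : H), A x⟫_ℂ).re : ℂ) := by
  have h := inner_apply_left_of_isSelfAdjoint hA x x
  rw [← inner_conj_symm] at h
  exact (Complex.conj_eq_iff_re.1 h).symm

/-- A densely defined symmetric operator which contains its adjoint is self-adjoint. -/
theorem isSelfAdjoint_of_symmetric (hd : Dense (A.domain : Set H))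
    (hs : ∀ x y : A.domain, ⟪A x, (y : H)⟫_ℂ = ⟪(x : H), A y⟫_ℂ)
    (hm : ∀ x y : H, (∀ z : A.domain, ⟪A z, x⟫_ℂ = ⟪(z : H), y⟫_ℂ) → (x, y) ∈ A.graph) :
    IsSelfAdjoint A := by
  rw [LinearPMap.isSelfAdjoint_def]
  apply LinearPMap.eq_of_eq_graph
  ext ⟨x, y⟩
  rw [LinearPMap.adjoint_graph_eq_graph_adjoint hd, Submodule.mem_adjoint_iff]
  constructor
  · intro h
    refine hm x y fun z => ?_
    exact sub_eq_zero.1 (h z (A z) ((LinearPMap.mem_graph_iff _).2 ⟨z, rfl, rfl⟩))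
  · intro h a b hab
    obtain ⟨x', hx, hy⟩ := (LinearPMap.mem_graph_iff _).1 h
    obtain ⟨a', ha, hb⟩ := (LinearPMap.mem_graph_iff _).1 hab
    dsimp only at *
    rw [← hx, ← hy, ← ha, ← hb, hs, sub_self]

theorem norm_sq_apply_add_smul (hA : IsSelfAdjoint A) (μ : ℝ) (x : A.domain) :
    ‖A x + (μ : ℂ) • (x : H)‖ ^ 2 =
      ‖A x‖ ^ 2 + 2 * μ * (⟪(x : H), A x⟫_ℂ).re + μ ^ 2 * ‖(x : H)‖ ^ 2 := by
  have h1 : (⟪A x, (μ : ℂ) • (x : H)⟫_ℂ).re = μ * (⟪(x : H), A x⟫_ℂ).re := by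
    rw [inner_smul_right, inner_apply_left_of_isSelfAdjoint hA]
    simp
  have h2 := norm_add_sq (𝕜 := ℂ) (A x) ((μ : ℂ) • (x : H))
  rw [h2, norm_smul, mul_pow]
  have h3 : RCLike.re ⟪A x, (μ : ℂ) • (x : H)⟫_ℂ = μ * (⟪(x : H), A x⟫_ℂ).re := h1
  rw [h3]
  simp
  ring

/-- `R` is the resolvent `(A + μ)⁻¹`. -/
structure IsResolvent (A : H →ₗ.[ℂ] H) (μ : ℝ) (R : H →L[ℂ] H) : Prop where
  mem : ∀ u, R u ∈ A.domain
  apply : ∀ u, A ⟨R u, mem u⟩ = u - (μ : ℂ) • R u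
  left_inv : ∀ x : A.domain, R (A x + (μ : ℂ) • (x : H)) = x

/-- Positivity gives `‖(A+μ)x‖ ≥ μ‖x‖`, so `A + μ` is injective with closed range. A vector
orthogonal to the range is an eigenvector of `A` for `-μ < 0`, which positivity excludes. -/
theorem exists_isResolvent (hA : IsSelfAdjoint A) (hp : IsNonneg A) {μ : ℝ} (hμ : 0 < μ) :
    ∃ R : H →L[ℂ] H, IsResolvent A μ R := by
  let T : A.domain →ₗ[ℂ] H := A.toFun + (μ : ℂ) • A.domain.subtype
  have hT : ∀ x, T x = A x + (μ : ℂ) • (x : H) := fun x => rfl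
  have hlow : ∀ x : A.domain, μ * ‖(x : H)‖ ≤ ‖T x‖ := by
    intro x
    have h := norm_sq_apply_add_smul hA μ x
    rw [← hT] at h
    have h1 := hp x
    refine abs_le_of_sq_le_sq' ?_ (norm_nonneg _) |>.2
    nlinarith [sq_nonneg ‖A x‖, mul_nonneg hμ.le h1]
  have hker : T.ker = ⊥ := by
    rw [LinearMap.ker_eq_bot']
    intro x hx
    have h := hlow x
    rw [hx, norm_zero] at h
    have : ‖(x : H)‖ ≤ 0 := by nlinarith [norm_nonneg (x : H)]
    exact Subtype.ext (norm_le_zero_iff.1 this)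
  have hclosed : IsClosed (LinearMap.range T : Set H) := by
    refine IsSeqClosed.isClosed fun y z hy hz => ?_
    choose x hx using hy
    have hc : CauchySeq fun n => (x n : H) := by
      rw [Metric.cauchySeq_iff]
      intro ε hε
      obtain ⟨N, hN⟩ := Metric.cauchySeq_iff.1 hz.cauchySeq (μ * ε) (by positivity)
      refine ⟨N, fun m hm n hn => ?_⟩
      have h1 := hN m hm n hn
      have h2 := hlow (x m - x n)
      rw [map_sub, hx, hx, ← dist_eq_norm] at h2
      rw [dist_eq_norm]
      exact lt_of_mul_lt_mul_left (h2.trans_lt h1) hμ.le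
    obtain ⟨w, hw⟩ := cauchySeq_tendsto_of_complete hc
    have hAx : Tendsto (fun n => A (x n)) atTop (𝓝 (z - (μ : ℂ) • w)) := by
      have : (fun n => A (x n)) = fun n => y n - (μ : ℂ) • (x n : H) := by
        funext n
        rw [← hx, hT]
        abel
      rw [this]
      exact hz.sub (hw.const_smul _)
    obtain ⟨h1, h2⟩ := exists_apply_eq_of_forall_inner hA (x := w) (y := z - (μ : ℂ) • w) (by
      intro v
      have h3 : Tendsto (fun n => ⟪A v, (x n : H)⟫_ℂ) atTop (𝓝 ⟪A v, w⟫_ℂ) :=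
        tendsto_const_nhds.inner hw
      have h4 : Tendsto (fun n => ⟪(v : H), A (x n)⟫_ℂ) atTop (𝓝 ⟪(v : H), z - (μ : ℂ) • w⟫_ℂ) :=
        tendsto_const_nhds.inner hAx
      simp_rw [inner_apply_left_of_isSelfAdjoint hA] at h3
      exact tendsto_nhds_unique h3 h4)
    refine ⟨⟨w, h1⟩, ?_⟩
    rw [hT, h2]
    simp
  have hrange : LinearMap.range T = ⊤ := by
    have : CompleteSpace (LinearMap.range T) := hclosed.completeSpace_coe
    rw [← Submodule.orthogonal_eq_bot_iff, Submodule.eq_bot_iff]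
    intro w hw
    rw [Submodule.mem_orthogonal] at hw
    -- Orthogonality to the range says `⟪A v, w⟫ = ⟪v, -μ w⟫` for all `v`, so `w` lies in the domain
    -- and `A w = -μ w`.
    obtain ⟨h1, h2⟩ := exists_apply_eq_of_forall_inner hA (x := w) (y := -((μ : ℂ) • w)) (by
      intro v
      have h3 := hw (T v) ⟨v, rfl⟩
      rw [hT, inner_add_left, inner_smul_left] at h3
      rw [inner_neg_right, inner_smul_right]
      simp only [Complex.conj_ofReal] at h3
      linear_combination h3)
    have h5 := hp ⟨w, h1⟩
    rw [h2] at h5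
    simp only [inner_neg_right, inner_smul_right, inner_self_eq_norm_sq_to_K] at h5
    norm_cast at h5
    simp only [Complex.neg_re] at h5
    have : ‖w‖ ^ 2 ≤ 0 := by
      simp only [Complex.coe_algebraMap] at h5
      norm_cast at h5
      nlinarith [sq_nonneg ‖w‖]
    simpa using this
  let e : A.domain ≃ₗ[ℂ] H := LinearEquiv.ofBijective T
    ⟨LinearMap.ker_eq_bot.1 hker, LinearMap.range_eq_top.1 hrange⟩
  have he : ∀ x, e x = T x := fun x => rfl
  refine ⟨LinearMap.mkContinuous (A.domain.subtype ∘ₗ e.symm.toLinearMap) μ⁻¹ ?_, ?_⟩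
  · intro u
    have h := hlow (e.symm u)
    rw [← he, LinearEquiv.apply_symm_apply] at h
    simp only [LinearMap.comp_apply, Submodule.subtype_apply, LinearEquiv.coe_coe]
    rw [inv_mul_eq_div, le_div_iff₀ hμ]
    linarith
  · refine ⟨fun u => (e.symm u).2, fun u => ?_, fun x => ?_⟩
    · have h := he (e.symm u)
      rw [LinearEquiv.apply_symm_apply, hT] at h
      change A (e.symm u) = u - (μ : ℂ) • ((e.symm u : A.domain) : H)
      rw [eq_sub_iff_add_eq]
      exact h.symm
    · change ((e.symm (A x + (μ : ℂ) • (x : H)) : A.domain) : H) = x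
      rw [← hT, ← he, LinearEquiv.symm_apply_apply]

namespace IsResolvent

variable {μ : ℝ} {R : H →L[ℂ] H}

theorem inner_left (hR : IsResolvent A μ R) (hA : IsSelfAdjoint A) (u v : H) :
    ⟪R u, v⟫_ℂ = ⟪u, R v⟫_ℂ := by
  have h := inner_apply_left_of_isSelfAdjoint hA ⟨R u, hR.mem u⟩ ⟨R v, hR.mem v⟩
  rw [hR.apply, hR.apply] at h
  simp only [inner_sub_left, inner_sub_right, inner_smul_left, inner_smul_right,
    Complex.conj_ofReal] at h
  linear_combination -h

theorem isSelfAdjoint (hR : IsResolvent A μ R) (hA : IsSelfAdjoint A) : IsSelfAdjoint R := by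
  rw [ContinuousLinearMap.isSelfAdjoint_iff_isSymmetric]
  exact fun u v => hR.inner_left hA u v

theorem injective (hR : IsResolvent A μ R) : Function.Injective R := by
  rw [injective_iff_map_eq_zero]
  intro u hu
  have h := hR.apply u
  have h0 : A ⟨R u, hR.mem u⟩ = 0 := by
    have : (⟨R u, hR.mem u⟩ : A.domain) = 0 := Subtype.ext hu
    rw [this, LinearPMap.map_zero]
  rw [h0, hu] at h
  simpa using h.symm

theorem norm_sq (hR : IsResolvent A μ R) (hA : IsSelfAdjoint A) (u : H) :
    ‖u‖ ^ 2 = ‖A ⟨R u, hR.mem u⟩‖ ^ 2 + 2 * μ * (⟪R u, A ⟨R u, hR.mem u⟩⟫_ℂ).re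
      + μ ^ 2 * ‖R u‖ ^ 2 := by
  have h := norm_sq_apply_add_smul hA μ ⟨R u, hR.mem u⟩
  rw [← h, hR.apply]
  simp

theorem norm_apply_le (hR : IsResolvent A μ R) (hA : IsSelfAdjoint A) (hp : IsNonneg A)
    (hμ : 0 ≤ μ) (u : H) : μ * ‖R u‖ ≤ ‖u‖ := by
  have h := hR.norm_sq hA u
  have h1 := hp ⟨R u, hR.mem u⟩
  refine abs_le_of_sq_le_sq' ?_ (norm_nonneg _) |>.2
  nlinarith [sq_nonneg ‖A ⟨R u, hR.mem u⟩‖, mul_nonneg hμ h1]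

theorem norm_apply_apply_le (hR : IsResolvent A μ R) (hA : IsSelfAdjoint A) (hp : IsNonneg A)
    (hμ : 0 ≤ μ) (u : H) : ‖A ⟨R u, hR.mem u⟩‖ ≤ ‖u‖ := by
  have h := hR.norm_sq hA u
  have h1 := hp ⟨R u, hR.mem u⟩
  refine abs_le_of_sq_le_sq' ?_ (norm_nonneg _) |>.2
  nlinarith [sq_nonneg (μ * ‖R u‖), mul_nonneg hμ h1]

theorem inner_self_eq (hR : IsResolvent A μ R) (u : H) :
    (⟪R u, u⟫_ℂ).re = (⟪R u, A ⟨R u, hR.mem u⟩⟫_ℂ).re + μ * ‖R u‖ ^ 2 := by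
  have h : (⟪R u, R u⟫_ℂ).re = ‖R u‖ ^ 2 := inner_self_eq_norm_sq (𝕜 := ℂ) _
  rw [hR.apply, inner_sub_right, inner_smul_right, Complex.sub_re, Complex.re_ofReal_mul, h]
  ring

theorem isPositive (hR : IsResolvent A μ R) (hA : IsSelfAdjoint A) (hp : IsNonneg A)
    (hμ : 0 ≤ μ) : 0 ≤ R := by
  rw [ContinuousLinearMap.nonneg_iff_isPositive, ContinuousLinearMap.isPositive_def']
  refine ⟨hR.isSelfAdjoint hA, fun u => ?_⟩
  have h := hR.inner_self_eq u
  have h1 := hp ⟨R u, hR.mem u⟩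
  change 0 ≤ (⟪R u, u⟫_ℂ).re
  rw [h]
  positivity

theorem denseRange (hR : IsResolvent A μ R) (hA : IsSelfAdjoint A) : DenseRange R := by
  have : (A.domain : Set H) ⊆ Set.range R := fun x hx => ⟨_, hR.left_inv ⟨x, hx⟩⟩
  exact hA.dense_domain.mono this

end IsResolvent

end SelfAdjoint

/-! ### The square root of a non-negative self-adjoint operator -/

section Sqrt

variable {A : H →ₗ.[ℂ] H} {R : H →L[ℂ] H}

theorem IsResolvent.spectrum_subset (hR : IsResolvent A 1 R) (hA : IsSelfAdjoint A)
    (hp : IsNonneg A) : spectrum ℝ R ⊆ Icc 0 1 := by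
  intro r hr
  refine ⟨spectrum_nonneg_of_nonneg (hR.isPositive hA hp zero_le_one) hr, ?_⟩
  have h := IsometricContinuousFunctionalCalculus.norm_spectrum_le (𝕜 := ℝ) R hr (hR.isSelfAdjoint hA)
  have h1 : ‖R‖ ≤ 1 := by
    refine ContinuousLinearMap.opNorm_le_bound _ zero_le_one fun u => ?_
    have := hR.norm_apply_le hA hp zero_le_one u
    linarith
  exact (le_abs_self r).trans (h.trans h1)

/-- The operator `C S⁻¹` with domain `Ran S`. -/
def mulInv (C S : H →L[ℂ] H) (hS : Function.Injective S) : H →ₗ.[ℂ] H where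
  domain := LinearMap.range S.toLinearMap
  toFun := C.toLinearMap ∘ₗ (LinearEquiv.ofInjective S.toLinearMap hS).symm.toLinearMap

theorem mem_graph_mulInv {C S : H →L[ℂ] H} {hS : Function.Injective S} {x z : H} :
    (x, z) ∈ (mulInv C S hS).graph ↔ ∃ u, S u = x ∧ C u = z := by
  rw [mem_graph_iff_exists]
  constructor
  · rintro ⟨⟨u, rfl⟩, h⟩
    refine ⟨u, rfl, ?_⟩
    rw [← h]
    change C u = C ((LinearEquiv.ofInjective S.toLinearMap hS).symm
      (LinearEquiv.ofInjective S.toLinearMap hS u))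
    rw [LinearEquiv.symm_apply_apply]
  · rintro ⟨u, rfl, rfl⟩
    refine ⟨⟨u, rfl⟩, ?_⟩
    change C ((LinearEquiv.ofInjective S.toLinearMap hS).symm
      (LinearEquiv.ofInjective S.toLinearMap hS u)) = _
    rw [LinearEquiv.symm_apply_apply]

/-- Since `A = (1-R)R⁻¹` with `R = (A+1)⁻¹`, the root is `C S⁻¹` for the commuting positive
operators `S = √R` and `C = √(1-R)`. Domain questions reduce to the identity `S² + C² = 1`. -/
theorem exists_isSqrtOf (hA : IsSelfAdjoint A) (hp : IsNonneg A) : ∃ B, IsSqrtOf A B := by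
  obtain ⟨R, hR⟩ := exists_isResolvent hA hp one_pos
  have hRs := hR.isSelfAdjoint hA
  have hspec := hR.spectrum_subset hA hp
  set S : H →L[ℂ] H := cfc Real.sqrt R with hSdef
  set C : H →L[ℂ] H := cfc (fun r : ℝ => Real.sqrt (1 - r)) R with hCdef
  have hSS : S * S = R := by
    rw [hSdef, ← cfc_mul Real.sqrt Real.sqrt R]
    conv_rhs => rw [← cfc_id ℝ R]
    exact cfc_congr fun r hr => Real.mul_self_sqrt (hspec hr).1
  have hCC : C * C = 1 - R := by
    rw [hCdef, ← cfc_mul _ _ R]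
    have : (1 : H →L[ℂ] H) - R = cfc (fun r : ℝ => 1 - r) R := by
      rw [cfc_sub (fun _ : ℝ => (1 : ℝ)) (fun r => r) R, cfc_const_one ℝ R, cfc_id' ℝ R]
    rw [this]
    exact cfc_congr fun r hr => Real.mul_self_sqrt (sub_nonneg.2 (hspec hr).2)
  have hSC : S * C = C * S := cfc_commute_cfc _ _ R
  have hSCpos : 0 ≤ S * C := by
    rw [hSdef, hCdef, ← cfc_mul _ _ R]
    exact cfc_nonneg fun r hr => mul_nonneg (Real.sqrt_nonneg _) (Real.sqrt_nonneg _)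
  have hSsa : IsSelfAdjoint S := cfc_predicate _ R
  have hCsa : IsSelfAdjoint C := cfc_predicate _ R
  have hSsym := ContinuousLinearMap.isSelfAdjoint_iff_isSymmetric.1 hSsa
  have hCsym := ContinuousLinearMap.isSelfAdjoint_iff_isSymmetric.1 hCsa
  replace hSsym : ∀ u v, ⟪S u, v⟫_ℂ = ⟪u, S v⟫_ℂ := hSsym
  replace hCsym : ∀ u v, ⟪C u, v⟫_ℂ = ⟪u, C v⟫_ℂ := hCsym
  have hSS' : ∀ u, S (S u) = R u := fun u => by rw [← hSS]; rfl
  have hCC' : ∀ u, C (C u) = u - R u := fun u => by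
    have := congrArg (fun T : H →L[ℂ] H => T u) hCC
    exact this
  have hSC' : ∀ u, S (C u) = C (S u) := fun u =>
    congrArg (fun T : H →L[ℂ] H => T u) hSC
  have hinj : Function.Injective S := by
    rw [injective_iff_map_eq_zero]
    intro u hu
    apply hR.injective
    rw [map_zero, ← hSS', hu, map_zero]
  set B := mulInv C S hinj with hB
  have hBg : ∀ {x z : H}, (x, z) ∈ B.graph ↔ ∃ u, S u = x ∧ C u = z := mem_graph_mulInv
  have hBap : ∀ x : B.domain, ∃ u, S u = x ∧ C u = B x := fun x =>
    hBg.1 ((LinearPMap.mem_graph_iff _).2 ⟨x, rfl, rfl⟩)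
  refine ⟨B, ?_, ?_, ?_⟩
  · refine isSelfAdjoint_of_symmetric ?_ ?_ ?_
    · refine (hR.denseRange hA).mono ?_
      rintro _ ⟨u, rfl⟩
      exact ⟨S u, hSS' u⟩
    · intro x y
      obtain ⟨u, hu, hu'⟩ := hBap x
      obtain ⟨v, hv, hv'⟩ := hBap y
      rw [← hu, ← hu', ← hv, ← hv', hCsym, hSsym, hSC']
    · intro x y h
      have h1 : C x = S y := by
        refine ext_inner_left ℂ fun u => ?_
        obtain ⟨hm, he⟩ := mem_graph_iff_exists.1 (hBg.2 ⟨u, rfl, rfl⟩)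
        have h2 := h ⟨S u, hm⟩
        rw [he, hCsym, hSsym] at h2
        exact h2
      -- A preimage `u` with `S u = x`, `C u = y` must be `(S² + C²)u = S x + C y`; the relation `C
      -- x = S y` shows that this choice works.
      refine hBg.2 ⟨S x + C y, ?_, ?_⟩
      · rw [map_add, hSS', hSC', ← h1, hCC']
        abel
      · rw [map_add, hCC', ← hSC', h1, hSS']
        abel
  · intro x
    obtain ⟨u, hu, hu'⟩ := hBap x
    rw [← hu, ← hu', hSsym]
    have := ContinuousLinearMap.nonneg_iff_isPositive _ |>.1 hSCpos
    exact this.re_inner_nonneg_right u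
  · intro x y
    constructor
    · intro h
      obtain ⟨hx, rfl⟩ := mem_graph_iff_exists.1 h
      set u := A ⟨x, hx⟩ + x with hu
      have h1 : R u = x := by
        have := hR.left_inv ⟨x, hx⟩
        rwa [Complex.ofReal_one, one_smul] at this
      refine ⟨C (S u), hBg.2 ⟨S u, by rw [hSS', h1], rfl⟩, hBg.2 ⟨C u, hSC' u, ?_⟩⟩
      rw [hCC', h1, hu]
      abel
    · rintro ⟨z, hxz, hzy⟩
      obtain ⟨u, rfl, rfl⟩ := hBg.1 hxz
      obtain ⟨v, hv, rfl⟩ := hBg.1 hzy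
      -- Here `x = S u` and `y = C v`, so this says `R(x + y) = x`, which is `A x = y` in resolvent
      -- form.
      have h1 : R (S u + C v) = S u := by
        rw [map_add, ← hSS' (C v), hSC', hv, hSC', hSC', hCC']
        abel
      refine mem_graph_iff_exists.2 ⟨h1 ▸ hR.mem _, ?_⟩
      have h2 := hR.apply (S u + C v)
      simp only [h1] at h2
      rw [h2]
      simp

theorem sqrtOp_spec (hA : IsSelfAdjoint A) (hp : IsNonneg A) : IsSqrtOf A (sqrtOp A) := by
  have h := exists_isSqrtOf hA hp
  rw [sqrtOp, dif_pos h]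
  exact h.choose_spec

/-- On the domain of `A`, `‖A ^ (1/2) x‖ ^ 2 = ⟪x, A x⟫`. -/
theorem IsSqrtOf.norm_sq {B : H →ₗ.[ℂ] H} (hB : IsSqrtOf A B) (x : A.domain) :
    ∃ hx : (x : H) ∈ B.domain, ‖B ⟨x, hx⟩‖ ^ 2 = (⟪(x : H), A x⟫_ℂ).re := by
  obtain ⟨z, hxz, hzy⟩ := (hB.sq x (A x)).1 (mem_graph_iff_exists.2 ⟨x.2, rfl⟩)
  obtain ⟨hx, rfl⟩ := mem_graph_iff_exists.1 hxz
  obtain ⟨hz, hy⟩ := mem_graph_iff_exists.1 hzy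
  refine ⟨hx, ?_⟩
  rw [← hy, ← inner_apply_left_of_isSelfAdjoint hB.selfAdjoint ⟨x, hx⟩ ⟨_, hz⟩]
  exact (inner_self_eq_norm_sq (𝕜 := ℂ) _).symm

/-- A self-adjoint operator is closed with respect to bounded sequences of images. -/
theorem exists_norm_apply_le_of_tendsto {B : H →ₗ.[ℂ] H} (hB : IsSelfAdjoint B) {ι : Type*}
    {l : Filter ι} [l.NeBot] {f : ι → H} {x : H} (hf : Tendsto f l (𝓝 x)) {C : ℝ}
    (hC : ∀ᶠ i in l, ∃ h : f i ∈ B.domain, ‖B ⟨f i, h⟩‖ ≤ C) :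
    ∃ h : x ∈ B.domain, ‖B ⟨x, h⟩‖ ≤ C := by
  -- Moving `B` to the approximants and passing to the limit makes `z ↦ ⟪x, B z⟫` bounded by `C`,
  -- which puts `x` in the domain of the adjoint, that is, of `B`.
  have hbd : ∀ z : B.domain, ‖⟪x, B z⟫_ℂ‖ ≤ C * ‖(z : H)‖ := by
    intro z
    have h1 : Tendsto (fun i => ‖⟪f i, B z⟫_ℂ‖) l (𝓝 ‖⟪x, B z⟫_ℂ‖) :=
      (hf.inner tendsto_const_nhds).norm
    refine le_of_tendsto h1 (hC.mono ?_)
    rintro i ⟨h, hi⟩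
    rw [← inner_apply_left_of_isSelfAdjoint hB ⟨f i, h⟩ z]
    exact (norm_inner_le_norm _ _).trans (by gcongr)
  have hC0 : 0 ≤ C := by
    obtain ⟨i, h, hi⟩ := hC.exists
    exact (norm_nonneg _).trans hi
  have hmem : x ∈ B.adjoint.domain := by
    rw [LinearPMap.mem_adjoint_domain_iff]
    exact AddMonoidHomClass.continuous_of_bound _ C hbd
  have hBeq := LinearPMap.isSelfAdjoint_def.1 hB
  have hx : x ∈ B.domain := hBeq ▸ hmem
  refine ⟨hx, ?_⟩
  have hd := hB.dense_domain
  set y := B ⟨x, hx⟩ with hy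
  have h2 : ∀ z : H, ‖⟪y, z⟫_ℂ‖ ≤ C * ‖z‖ := by
    intro z
    refine hd.induction (P := fun z => ‖⟪y, z⟫_ℂ‖ ≤ C * ‖z‖) ?_ ?_ z
    · intro w hw
      have := inner_apply_left_of_isSelfAdjoint hB ⟨x, hx⟩ ⟨w, hw⟩
      rw [this]
      exact hbd ⟨w, hw⟩
    · exact isClosed_le (by fun_prop) (by fun_prop)
  have h3 := h2 y
  rw [inner_self_eq_norm_sq_to_K] at h3
  simp only [Complex.coe_algebraMap] at h3
  norm_cast at h3
  rw [Real.norm_of_nonneg (by positivity)] at h3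
  by_contra hlt
  push Not at hlt
  nlinarith [norm_nonneg y]

end Sqrt

/-! ### Stone's theorem for a non-negative self-adjoint operator -/

section Stone

/-- The function `r ↦ r⁻¹ - 1`, cut off near `0`. -/
def cutoffInv (n : ℕ) (r : ℝ) : ℝ := (max r (1 / ((n : ℝ) + 1)))⁻¹ - 1

theorem one_div_succ_pos (n : ℕ) : (0 : ℝ) < 1 / ((n : ℝ) + 1) := by positivity

theorem continuous_cutoffInv (n : ℕ) : Continuous (cutoffInv n) := by
  have h : ∀ r : ℝ, max r (1 / ((n : ℝ) + 1)) ≠ 0 := fun r =>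
    ((one_div_succ_pos n).trans_le (le_max_right _ _)).ne'
  unfold cutoffInv
  exact ((continuous_id.max continuous_const).inv₀ h).sub continuous_const

theorem cutoffInv_of_le {n : ℕ} {r : ℝ} (h : 1 / ((n : ℝ) + 1) ≤ r) : cutoffInv n r = r⁻¹ - 1 := by
  rw [cutoffInv, max_eq_left h]

theorem mul_inv_max_mem {n : ℕ} {r : ℝ} (h0 : 0 ≤ r) :
    0 ≤ (max r (1 / ((n : ℝ) + 1)))⁻¹ * r ∧ (max r (1 / ((n : ℝ) + 1)))⁻¹ * r ≤ 1 := by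
  have h : 0 < max r (1 / ((n : ℝ) + 1)) := (one_div_succ_pos n).trans_le (le_max_right _ _)
  refine ⟨by positivity, ?_⟩
  rw [inv_mul_eq_div, div_le_one h]
  exact le_max_left _ _

theorem abs_cutoffInv_mul_le {n : ℕ} {r : ℝ} (h0 : 0 ≤ r) (h1 : r ≤ 1) :
    |cutoffInv n r * r| ≤ 1 := by
  have h := mul_inv_max_mem (n := n) h0
  rw [cutoffInv, sub_mul, one_mul, abs_le]
  constructor <;> linarith

theorem abs_cutoffInv_mul_mul_sub_le {n : ℕ} {r : ℝ} (h0 : 0 ≤ r) :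
    |cutoffInv n r * r * r - (1 - r) * r| ≤ 1 / ((n : ℝ) + 1) := by
  rcases le_or_gt (1 / ((n : ℝ) + 1)) r with h | h
  · have hr : r ≠ 0 := ((one_div_succ_pos n).trans_le h).ne'
    rw [cutoffInv_of_le h]
    have : (r⁻¹ - 1) * r * r - (1 - r) * r = 0 := by
      field_simp
      ring
    rw [this, abs_zero]
    exact (one_div_succ_pos n).le
  · have h2 := mul_inv_max_mem (n := n) h0
    have : cutoffInv n r * r * r - (1 - r) * r =
        ((max r (1 / ((n : ℝ) + 1)))⁻¹ * r - 1) * r := by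
      rw [cutoffInv]
      ring
    rw [this, abs_mul, abs_of_nonneg h0]
    have h3 : |(max r (1 / ((n : ℝ) + 1)))⁻¹ * r - 1| ≤ 1 := by
      rw [abs_le]
      constructor <;> linarith
    nlinarith

/-- The phase `exp (-i t (r⁻¹ - 1))`, cut off near `0`. -/
def cutoffPhase (n : ℕ) (t r : ℝ) : ℂ := Complex.exp (t * (-(Complex.I * cutoffInv n r)))

theorem norm_cutoffPhase (n : ℕ) (t r : ℝ) : ‖cutoffPhase n t r‖ = 1 := by
  rw [cutoffPhase, Complex.norm_exp]
  simp

theorem continuous_cutoffPhase (n : ℕ) (t : ℝ) : Continuous (cutoffPhase n t) := by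
  have := continuous_cutoffInv n
  unfold cutoffPhase
  fun_prop

/-- The phases agree for `r ≥ 1/(N+1)`; below that the factor `r` is small while the phases have
modulus one. The bound does not depend on `t`, which is what makes the limiting group strongly
continuous. -/
theorem norm_cutoffPhase_sub_mul_le {N n m : ℕ} (hn : N ≤ n) (hm : N ≤ m) (t : ℝ) {r : ℝ}
    (h0 : 0 ≤ r) : ‖(cutoffPhase n t r - cutoffPhase m t r) * r‖ ≤ 2 * (1 / ((N : ℝ) + 1)) := by
  rw [norm_mul, Complex.norm_real, Real.norm_of_nonneg h0]
  rcases le_or_gt (1 / ((N : ℝ) + 1)) r with h | h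
  · have hn' : 1 / ((n : ℝ) + 1) ≤ r := le_trans (by gcongr) h
    have hm' : 1 / ((m : ℝ) + 1) ≤ r := le_trans (by gcongr) h
    rw [cutoffPhase, cutoffPhase, cutoffInv_of_le hn', cutoffInv_of_le hm', sub_self, norm_zero,
      zero_mul]
    positivity
  · have h1 := norm_sub_le (cutoffPhase n t r) (cutoffPhase m t r)
    rw [norm_cutoffPhase, norm_cutoffPhase] at h1
    have h2 := norm_nonneg (cutoffPhase n t r - cutoffPhase m t r)
    nlinarith

/-- Strongly bounded sequences converge on all vectors if they converge on a dense range. -/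
theorem tendsto_of_denseRange {T : ℕ → H →L[ℂ] H} {S R : H →L[ℂ] H} (hR : DenseRange R) {C : ℝ}
    (hC : ∀ n x, ‖T n x‖ ≤ C * ‖x‖) (h : ∀ u, Tendsto (fun n => T n (R u)) atTop (𝓝 (S (R u))))
    (x : H) : Tendsto (fun n => T n x) atTop (𝓝 (S x)) := by
  rw [Metric.tendsto_atTop]
  intro ε hε
  set K := |C| + ‖S‖ + 1 with hK
  have hK0 : 0 < K := by positivity
  obtain ⟨_, ⟨u, rfl⟩, hu⟩ := Metric.dense_iff.1 hR x (ε / (2 * K)) (by positivity) |>.imp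
    fun y hy => And.intro hy.2 hy.1
  rw [Metric.mem_ball, dist_comm, dist_eq_norm] at hu
  obtain ⟨N, hN⟩ := Metric.tendsto_atTop.1 (h u) (ε / 2) (by positivity)
  refine ⟨N, fun n hn => ?_⟩
  have h1 := hN n hn
  rw [dist_eq_norm] at h1 ⊢
  have h2 : T n x - S x = T n (x - R u) + (T n (R u) - S (R u)) - S (x - R u) := by
    simp only [map_sub]
    abel
  have h3 : ‖T n (x - R u)‖ ≤ |C| * ‖x - R u‖ := (hC n _).trans (by gcongr; exact le_abs_self C)
  have h4 := S.le_opNorm (x - R u)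
  have h5 : K * ‖x - R u‖ < ε / 2 := by
    rw [lt_div_iff₀ (by positivity)] at hu
    linarith
  calc ‖T n x - S x‖ ≤ ‖T n (x - R u)‖ + ‖T n (R u) - S (R u)‖ + ‖S (x - R u)‖ := by
        rw [h2]
        exact (norm_sub_le _ _).trans (by gcongr; exact norm_add_le _ _)
    _ < ε := by nlinarith [norm_nonneg (x - R u)]

variable {A : H →ₗ.[ℂ] H}

/-- **Stone's theorem**: a non-negative self-adjoint operator generates a unitary group. -/
theorem exists_isUnitaryGroupOf (hA : IsSelfAdjoint A) (hp : IsNonneg A) :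
    ∃ W, IsUnitaryGroupOf A W := by
  obtain ⟨R, hR⟩ := exists_isResolvent hA hp one_pos
  have hRs := hR.isSelfAdjoint hA
  have hRn : IsStarNormal R := hRs.isStarNormal
  have hspec : ∀ z ∈ spectrum ℂ R, z = (z.re : ℂ) ∧ 0 ≤ z.re ∧ z.re ≤ 1 := by
    intro z hz
    have h1 := hRs.mem_spectrum_eq_re hz
    have h2 : z.re ∈ spectrum ℝ R := by
      rw [← spectrum.algebraMap_mem_iff ℂ, Complex.coe_algebraMap, ← h1]
      exact hz
    exact ⟨h1, hR.spectrum_subset hA hp h2⟩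
  have hgc : ∀ n, Continuous fun z : ℂ => (cutoffInv n z.re : ℂ) := fun n =>
    Complex.continuous_ofReal.comp ((continuous_cutoffInv n).comp Complex.continuous_re)
  have hfc : ∀ n t, Continuous fun z : ℂ => cutoffPhase n t z.re := fun n t =>
    (continuous_cutoffPhase n t).comp Complex.continuous_re
  -- `G n` is a bounded approximation of `A = R⁻¹ - 1`, cut off at high energy, and `W n t = exp(-i
  -- t G n)`. The unitary group of `A` is the strong limit of the `W n`.
  set G : ℕ → H →L[ℂ] H := fun n => cfc (fun z : ℂ => (cutoffInv n z.re : ℂ)) R with hG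
  set W : ℕ → ℝ → H →L[ℂ] H := fun n t => cfc (fun z : ℂ => cutoffPhase n t z.re) R with hW
  have hRid : R = cfc (fun z : ℂ => (z.re : ℂ)) R := by
    conv_lhs => rw [← cfc_id' ℂ R]
    exact cfc_congr fun z hz => (hspec z hz).1
  have hWunit : ∀ n t, W n t ∈ unitary (H →L[ℂ] H) := by
    intro n t
    rw [hW]
    dsimp only
    rw [cfc_unitary_iff (R := ℂ) _ R hRn ((hfc n t).continuousOn)]
    intro z hz
    have := Complex.normSq_eq_norm_sq (cutoffPhase n t z.re)
    rw [norm_cutoffPhase] at this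
    rw [RCLike.star_def, ← Complex.normSq_eq_conj_mul_self, this]
    simp
  have hWnorm : ∀ n t x, ‖W n t x‖ = ‖x‖ := fun n t x =>
    ContinuousLinearMap.norm_map_of_mem_unitary (hWunit n t) x
  have hWadd : ∀ n s t, W n (s + t) = W n s * W n t := by
    intro n s t
    simp only [hW]
    rw [← cfc_mul _ _ R (hfc n s).continuousOn (hfc n t).continuousOn]
    refine cfc_congr fun z hz => ?_
    simp only [cutoffPhase]
    rw [← Complex.exp_add]
    push_cast
    ring_nf
  have hWexp : ∀ n t, W n t = NormedSpace.exp (t • (-(Complex.I • G n))) := by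
    intro n t
    have hc1 : Continuous fun z : ℂ => -(Complex.I * (cutoffInv n z.re : ℂ)) :=
      (continuous_const.mul (hgc n)).neg
    have hc2 : Continuous fun z : ℂ => (t : ℂ) * (-(Complex.I * (cutoffInv n z.re : ℂ))) :=
      continuous_const.mul hc1
    have h1 : t • (-(Complex.I • G n)) =
        cfc (fun z : ℂ => (t : ℂ) * (-(Complex.I * cutoffInv n z.re))) R := by
      rw [cfc_const_mul (t : ℂ) _ R hc1.continuousOn, cfc_neg, cfc_const_mul _ _ R
        (hgc n).continuousOn]
      rfl
    have hn : IsStarNormal (cfc (fun z : ℂ => (t : ℂ) * (-(Complex.I * cutoffInv n z.re))) R) :=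
      cfc_predicate _ R
    rw [h1, ← CFC.complex_exp_eq_normedSpace_exp hn, ← cfc_comp' Complex.exp _ R
      (by fun_prop) hc2.continuousOn]
    rfl
  have hWderiv : ∀ n x t, HasDerivAt (fun t => W n t x) (W n t (-(Complex.I • G n x))) t := by
    intro n x t
    have h1 := hasDerivAt_exp_smul_const (𝕂 := ℝ) (-(Complex.I • G n)) t
    simp_rw [← hWexp] at h1
    exact ((ContinuousLinearMap.apply ℂ H x).restrictScalars ℝ).hasFDerivAt.comp_hasDerivAt t h1
  have hcauchyR : ∀ N n m, N ≤ n → N ≤ m → ∀ t u,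
      ‖W n t (R u) - W m t (R u)‖ ≤ 2 * (1 / ((N : ℝ) + 1)) * ‖u‖ := by
    intro N n m hn hm t u
    have h1 : (W n t - W m t) * R =
        cfc (fun z : ℂ => (cutoffPhase n t z.re - cutoffPhase m t z.re) * (z.re : ℂ)) R := by
      rw [cfc_mul (fun z : ℂ => cutoffPhase n t z.re - cutoffPhase m t z.re) _ R
        ((hfc n t).sub (hfc m t)).continuousOn (by fun_prop), ← hRid,
        cfc_sub _ _ R (hfc n t).continuousOn (hfc m t).continuousOn]
    have h2 : ‖(W n t - W m t) * R‖ ≤ 2 * (1 / ((N : ℝ) + 1)) := by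
      rw [h1]
      exact norm_cfc_le (by positivity) fun z hz =>
        norm_cutoffPhase_sub_mul_le hn hm t (hspec z hz).2.1
    exact ((W n t - W m t) * R).le_of_opNorm_le h2 u
  have hunif : ∀ x, UniformCauchySeqOn (fun n t => W n t x) atTop Set.univ := by
    intro x
    rw [Metric.uniformCauchySeqOn_iff]
    intro ε hε
    obtain ⟨_, ⟨u, rfl⟩, hu⟩ := Metric.dense_iff.1 (hR.denseRange hA) x (ε / 4) (by positivity)
      |>.imp fun y hy => And.intro hy.2 hy.1
    rw [Metric.mem_ball, dist_comm, dist_eq_norm] at hu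
    obtain ⟨N, hN⟩ := exists_nat_one_div_lt (show 0 < ε / (4 * (‖u‖ + 1)) by positivity)
    refine ⟨N, fun m hm n hn t _ => ?_⟩
    have h1 := hcauchyR N m n hm hn t u
    have h2 : W m t x - W n t x = W m t (x - R u) + (W m t (R u) - W n t (R u))
        - W n t (x - R u) := by
      simp only [map_sub]
      abel
    have h3 : 2 * (1 / ((N : ℝ) + 1)) * ‖u‖ ≤ ε / 2 := by
      rw [lt_div_iff₀ (by positivity)] at hN
      nlinarith [one_div_succ_pos N, norm_nonneg u]
    rw [dist_eq_norm, h2]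
    have h4 := norm_sub_le (W m t (x - R u) + (W m t (R u) - W n t (R u))) (W n t (x - R u))
    have h5 := norm_add_le (W m t (x - R u)) (W m t (R u) - W n t (R u))
    rw [hWnorm] at h4 h5
    linarith
  have hlim : ∀ t x, ∃ y, Tendsto (fun n => W n t x) atTop (𝓝 y) := fun t x =>
    cauchySeq_tendsto_of_complete ((hunif x).cauchySeq (Set.mem_univ t))
  choose Wl hWl using hlim
  have hWl' : ∀ t, Tendsto (fun n x => W n t x) atTop (𝓝 (Wl t)) := fun t =>
    tendsto_pi_nhds.2 (hWl t)
  set Z : ℝ → H →L[ℂ] H := fun t => continuousLinearMapOfTendsto _ (hWl' t) with hZ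
  have hZl : ∀ t x, Tendsto (fun n => W n t x) atTop (𝓝 (Z t x)) := hWl
  have hZu : ∀ x, TendstoUniformly (fun n t => W n t x) (fun t => Z t x) atTop := fun x =>
    tendstoUniformlyOn_univ.1 ((hunif x).tendstoUniformlyOn_of_tendsto fun t _ => hZl t x)
  have hZnorm : ∀ t x, ‖Z t x‖ = ‖x‖ := fun t x =>
    tendsto_nhds_unique (hZl t x).norm (by simp_rw [hWnorm]; exact tendsto_const_nhds)
  have hZadd : ∀ s t, Z (s + t) = Z s * Z t := by
    intro s t
    ext x
    refine tendsto_nhds_unique (hZl (s + t) x) ?_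
    have h1 : Tendsto (fun n => W n s (W n t x) - W n s (Z t x)) atTop (𝓝 0) := by
      refine tendsto_zero_iff_norm_tendsto_zero.2 ?_
      simp_rw [← map_sub, hWnorm]
      exact tendsto_zero_iff_norm_tendsto_zero.1 (by simpa using (hZl t x).sub_const (Z t x))
    have h2 := h1.add (hZl s (Z t x))
    simp only [sub_add_cancel, zero_add] at h2
    simp_rw [hWadd]
    exact h2
  have hZ0 : Z 0 = 1 := by
    ext x
    refine tendsto_nhds_unique (hZl 0 x) ?_
    have : ∀ n, W n 0 = 1 := fun n => by
      rw [hWexp, zero_smul, NormedSpace.exp_zero]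
    simp_rw [this]
    exact tendsto_const_nhds
  have hZunit : ∀ t, Z t ∈ unitary (H →L[ℂ] H) := by
    intro t
    have h1 : star (Z t) * Z t = 1 := (Z t).norm_map_iff_adjoint_comp_self.1 (hZnorm t)
    have h2 : Z t * Z (-t) = 1 := by rw [← hZadd, add_neg_cancel, hZ0]
    have h3 : star (Z t) = Z (-t) := by
      rw [← mul_one (star (Z t)), ← h2, ← mul_assoc, h1, one_mul]
    exact Unitary.mem_iff.2 ⟨h1, by rw [h3, h2]⟩
  have hZstar : ∀ t x y, ⟪Z t x, y⟫_ℂ = ⟪x, Z (-t) y⟫_ℂ := by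
    intro t x y
    rw [← ContinuousLinearMap.inner_map_map_of_mem_unitary (hZunit t) x]
    change _ = ⟪_, (Z t * Z (-t)) y⟫_ℂ
    rw [← hZadd, add_neg_cancel, hZ0]
    rfl
  -- The limit is `A R u = u - R u`. The operators `G n R` have norm at most one, and on `Ran R`
  -- they converge at rate `1/(n+1)`; density does the rest.
  have hGR : ∀ u, Tendsto (fun n => G n (R u)) atTop (𝓝 (u - R u)) := by
    have h1 : ∀ n x, ‖(G n * R) x‖ ≤ 1 * ‖x‖ := by
      intro n x
      refine (G n * R).le_of_opNorm_le ?_ x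
      have : G n * R = cfc (fun z : ℂ => (cutoffInv n z.re : ℂ) * (z.re : ℂ)) R := by
        rw [cfc_mul _ _ R (hgc n).continuousOn (by fun_prop), ← hRid]
      rw [this]
      refine norm_cfc_le zero_le_one fun z hz => ?_
      rw [← Complex.ofReal_mul, Complex.norm_real]
      exact abs_cutoffInv_mul_le (hspec z hz).2.1 (hspec z hz).2.2
    refine tendsto_of_denseRange (T := fun n => G n * R) (S := 1 - R) (hR.denseRange hA) h1 ?_
    intro u
    rw [tendsto_iff_norm_sub_tendsto_zero]
    have h2 : Tendsto (fun n : ℕ => 1 / ((n : ℝ) + 1) * ‖u‖) atTop (𝓝 0) := by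
      simpa using tendsto_one_div_add_atTop_nhds_zero_nat.mul_const ‖u‖
    refine squeeze_zero (fun _ => norm_nonneg _) (fun n => ?_) h2
    have h3 : G n * R * R - (1 - R) * R =
        cfc (fun z : ℂ => (cutoffInv n z.re : ℂ) * (z.re : ℂ) * (z.re : ℂ)
          - (1 - (z.re : ℂ)) * (z.re : ℂ)) R := by
      have hc := hgc n
      rw [cfc_sub _ _ R (by fun_prop) (by fun_prop),
        cfc_mul (fun z : ℂ => (cutoffInv n z.re : ℂ) * (z.re : ℂ)) _ R (by fun_prop) (by fun_prop),
        cfc_mul _ _ R (hgc n).continuousOn (by fun_prop),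
        cfc_mul (fun z : ℂ => 1 - (z.re : ℂ)) _ R (by fun_prop) (by fun_prop),
        cfc_sub (fun _ : ℂ => (1 : ℂ)) _ R (by fun_prop) (by fun_prop),
        cfc_const_one ℂ R, ← hRid]
    have h4 : ‖G n * R * R - (1 - R) * R‖ ≤ 1 / ((n : ℝ) + 1) := by
      rw [h3]
      refine norm_cfc_le (by positivity) fun z hz => ?_
      have := abs_cutoffInv_mul_mul_sub_le (n := n) (hspec z hz).2.1
      rw [← Real.norm_eq_abs, ← Complex.norm_real] at this
      push_cast at this
      exact this
    exact (G n * R * R - (1 - R) * R).le_of_opNorm_le h4 u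
  have hderiv : ∀ x : A.domain, HasDerivAt (fun t => Z t x) (-(Complex.I • A x)) 0 := by
    intro x
    have hGx : Tendsto (fun n => G n x) atTop (𝓝 (A x)) := by
      have := hGR (A x + ((1 : ℝ) : ℂ) • (x : H))
      rw [hR.left_inv] at this
      simpa using this
    -- For `x` in the domain the derivatives of `t ↦ W n t x` converge uniformly in `t`, so the
    -- limit is differentiable with the limiting derivative.
    have h1 : TendstoUniformly (fun n t => W n t (-(Complex.I • G n x)))
        (fun t => Z t (-(Complex.I • A x))) atTop := by
      have h2 := hZu (-(Complex.I • A x))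
      rw [Metric.tendstoUniformly_iff] at h2 ⊢
      intro ε hε
      filter_upwards [h2 (ε / 2) (by positivity), Metric.tendsto_nhds.1 hGx (ε / 2) (by positivity)]
        with n hn1 hn2 t
      have h3 : dist (W n t (-(Complex.I • A x))) (W n t (-(Complex.I • G n x))) < ε / 2 := by
        rw [dist_comm, dist_eq_norm] at hn2 ⊢
        rw [← map_sub, hWnorm, ← neg_sub, norm_neg]
        rw [neg_sub_neg, ← smul_sub, norm_smul, Complex.norm_I, one_mul, norm_sub_rev]
        exact hn2
      linarith [dist_triangle (Z t (-(Complex.I • A x))) (W n t (-(Complex.I • A x)))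
        (W n t (-(Complex.I • G n x))), hn1 t]
    have h2 := hasDerivAt_of_tendstoUniformly h1
      (Eventually.of_forall fun n t => hWderiv n x t) (fun t => hZl t x) 0
    rw [hZ0] at h2
    exact h2
  refine ⟨Z, hZunit, hZadd, fun x => ?_, fun x y => ⟨fun h => ?_, fun h => ?_⟩⟩
  · refine (hZu x).continuous (Frequently.of_forall fun n => ?_)
    exact continuous_iff_continuousAt.2 fun t => (hWderiv n x t).continuousAt
  · obtain ⟨hx, rfl⟩ := mem_graph_iff_exists.1 h
    exact hderiv ⟨x, hx⟩
  -- Conversely, differentiating `⟪Z t z, x⟫ = ⟪z, Z(-t) x⟫` at `0` for `z` in the domain gives `⟪A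
  -- z, x⟫ = ⟪z, y⟫`, and self-adjointness places `(x, y)` in the graph.
  · refine mem_graph_iff_exists.2 (exists_apply_eq_of_forall_inner hA fun z => ?_)
    have h1 : HasDerivAt (fun t : ℝ => ⟪Z t z, x⟫_ℂ) ⟪-(Complex.I • A z), x⟫_ℂ 0 := by
      have := (hderiv z).inner ℂ (hasDerivAt_const (0 : ℝ) x)
      simpa using this
    have h2 : HasDerivAt (fun t : ℝ => ⟪(z : H), Z (-t) x⟫_ℂ) ⟪(z : H), Complex.I • y⟫_ℂ 0 := by
      have h3 : HasDerivAt (fun t : ℝ => Z (-t) x) (Complex.I • y) 0 := by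
        have h4 : HasDerivAt (fun t : ℝ => Z t x) (-(Complex.I • y)) (-(0 : ℝ)) := by
          rwa [neg_zero]
        have := h4.scomp (0 : ℝ) (hasDerivAt_neg (0 : ℝ))
        simpa [Function.comp_def] using this
      have := (hasDerivAt_const (0 : ℝ) (z : H)).inner ℂ h3
      exact this.congr_deriv (by rw [inner_zero_left, add_zero])
    simp_rw [hZstar] at h1
    have h5 := h1.unique h2
    rw [inner_neg_left, inner_smul_left, inner_smul_right, Complex.conj_I, neg_mul, neg_neg] at h5
    exact mul_left_cancel₀ Complex.I_ne_zero h5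

theorem isUnitaryGroupOf_expGroup (hA : IsSelfAdjoint A) (hp : IsNonneg A) :
    IsUnitaryGroupOf A (expGroup A) := by
  have h := exists_isUnitaryGroupOf hA hp
  rw [expGroup, dif_pos h]
  exact h.choose_spec

end Stone

/-! ### Form bounds from operator bounds -/

section FormBound

/-- The sequence is log-convex, so its ratios increase: a first ratio above `q` would force growth
faster than `C q ^ n`. -/
theorem le_mul_of_sq_le_mul {a : ℕ → ℝ} (h0 : ∀ n, 0 ≤ a n)
    (h : ∀ n, a (n + 1) ^ 2 ≤ a n * a (n + 2)) {C q : ℝ} (hq : 0 ≤ q)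
    (hC : ∀ n, a n ≤ C * q ^ n) : a 1 ≤ q * a 0 := by
  by_contra! hlt
  have ha0 : 0 < a 0 := by
    rcases (h0 0).eq_or_lt with h1 | h1
    · have h2 := h 0
      rw [← h1, zero_mul, zero_add] at h2
      have : a 1 = 0 := by simpa using le_antisymm h2 (sq_nonneg _)
      rw [this, ← h1] at hlt
      simp at hlt
    · exact h1
  have ha1 : 0 < a 1 := lt_of_le_of_lt (by positivity) hlt
  have hq0 : 0 < q := by
    rcases hq.eq_or_lt with h1 | h1
    · have := hC 1
      rw [← h1] at this
      simp at this
      linarith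
    · exact h1
  have hr : q < a 1 / a 0 := by rwa [lt_div_iff₀ ha0]
  set r := a 1 / a 0 with hrdef
  have hr0 : 0 < r := hq0.trans hr
  have hstep : ∀ n, 0 < a n ∧ r * a n ≤ a (n + 1) := by
    intro n
    induction n with
    | zero => exact ⟨ha0, by rw [hrdef, div_mul_cancel₀ _ ha0.ne']⟩
    | succ n ih =>
      have h1 : 0 < a (n + 1) := lt_of_lt_of_le (mul_pos hr0 ih.1) ih.2
      refine ⟨h1, ?_⟩
      have h2 := h n
      have h3 : (r * a (n + 1)) * a n ≤ a (n + 2) * a n := by nlinarith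
      exact le_of_mul_le_mul_right h3 ih.1
  have hpow : ∀ n, r ^ n * a 0 ≤ a n := by
    intro n
    induction n with
    | zero => simp
    | succ n ih =>
      calc r ^ (n + 1) * a 0 = r * (r ^ n * a 0) := by ring
        _ ≤ r * a n := by gcongr
        _ ≤ a (n + 1) := (hstep n).2
  have hgt : 1 < r / q := by rwa [one_lt_div hq0]
  obtain ⟨n, hn⟩ := pow_unbounded_of_one_lt (C / a 0) hgt
  rw [div_lt_iff₀ ha0, div_pow, div_mul_eq_mul_div, lt_div_iff₀ (by positivity)] at hn
  linarith [hpow n, hC n]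

variable {A : H →ₗ.[ℂ] H}

/-- An operator bound for a symmetric perturbation implies the corresponding form bound. -/
theorem abs_inner_le_of_norm_le (hA : IsSelfAdjoint A) (hp : IsNonneg A) {B : A.domain →ₗ[ℂ] H}
    (hB : ∀ x y : A.domain, ⟪B x, (y : H)⟫_ℂ = ⟪(x : H), B y⟫_ℂ) {a b : ℝ} (ha : 0 ≤ a) (hb : 0 ≤ b)
    (hbound : ∀ x : A.domain, ‖B x‖ ≤ a * ‖A x‖ + b * ‖(x : H)‖) {μ : ℝ} (hμ : 0 < μ)
    (x : A.domain) :
    |(⟪(x : H), B x⟫_ℂ).re| ≤ (a + b / μ) * ((⟪(x : H), A x⟫_ℂ).re + μ * ‖(x : H)‖ ^ 2) := by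
  obtain ⟨R, hR⟩ := exists_isResolvent hA hp hμ
  have hRpos := hR.isPositive hA hp hμ.le
  set S := CFC.sqrt R with hS
  have hSS : S * S = R := CFC.sqrt_mul_sqrt_self R hRpos
  have hSsa : IsSelfAdjoint S := (CFC.sqrt_nonneg R).isSelfAdjoint
  have hSsym : ∀ u v, ⟪S u, v⟫_ℂ = ⟪u, S v⟫_ℂ :=
    ContinuousLinearMap.isSelfAdjoint_iff_isSymmetric.1 hSsa
  have hRS : ∀ u v, ⟪R u, v⟫_ℂ = ⟪S u, S v⟫_ℂ := fun u v => by
    rw [← hSS, ← hSsym]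
    rfl
  -- `T = B R` is symmetric for the form `⟪R u, v⟫ = ⟪S u, S v⟫`, though not for the inner product
  -- of `H`. Its operator bound `q` in `H` is transferred to the seminorm `‖S u‖` by iterating
  -- Cauchy–Schwarz. With `x = R u`, the quantity `‖S u‖²` is `⟪x, (A+μ)x⟫`.
  let T : H → H := fun u => B ⟨R u, hR.mem u⟩
  set q := a + b / μ with hq
  have hq0 : 0 ≤ q := by positivity
  have hT : ∀ u, ‖T u‖ ≤ q * ‖u‖ := by
    intro u
    have h1 := hbound ⟨R u, hR.mem u⟩
    have h2 := hR.norm_apply_apply_le hA hp hμ.le u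
    have h3 : ‖R u‖ ≤ ‖u‖ / μ := by
      rw [le_div_iff₀ hμ, mul_comm]
      exact hR.norm_apply_le hA hp hμ.le u
    calc ‖T u‖ ≤ a * ‖A ⟨R u, hR.mem u⟩‖ + b * ‖R u‖ := h1
      _ ≤ a * ‖u‖ + b * (‖u‖ / μ) := by gcongr
      _ = q * ‖u‖ := by rw [hq]; ring
  have hTS : ∀ u, ‖S (T u)‖ ^ 2 ≤ ‖S u‖ * ‖S (T (T u))‖ := by
    intro u
    have h1 : ⟪S (T u), S (T u)⟫_ℂ = ⟪S u, S (T (T u))⟫_ℂ := by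
      rw [← hRS, ← hRS, hR.inner_left hA]
      exact hB ⟨R u, hR.mem u⟩ ⟨R (T u), hR.mem _⟩
    have h2 : ‖S (T u)‖ ^ 2 = (⟪S (T u), S (T u)⟫_ℂ).re :=
      (inner_self_eq_norm_sq (𝕜 := ℂ) _).symm
    rw [h2, h1]
    exact re_inner_le_norm (𝕜 := ℂ) _ _
  have key : ∀ u, ‖S (T u)‖ ≤ q * ‖S u‖ := by
    intro u
    -- Log-convexity of `n ↦ ‖S Tⁿ u‖` is Cauchy–Schwarz for the form; the crude growth bound `‖S‖
    -- ‖u‖ qⁿ` suffices because only the rate `q` matters.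
    refine le_mul_of_sq_le_mul (a := fun n => ‖S (T^[n] u)‖) (fun n => norm_nonneg _)
      (fun n => ?_) hq0 (C := ‖S‖ * ‖u‖) (fun n => ?_)
    · have := hTS (T^[n] u)
      simpa only [Function.iterate_succ_apply'] using this
    · have h1 : ‖T^[n] u‖ ≤ q ^ n * ‖u‖ := by
        induction n with
        | zero => simp
        | succ n ih =>
          rw [Function.iterate_succ_apply']
          calc _ ≤ q * ‖T^[n] u‖ := hT _
            _ ≤ q * (q ^ n * ‖u‖) := by gcongr
            _ = _ := by ring
      calc ‖S (T^[n] u)‖ ≤ ‖S‖ * ‖T^[n] u‖ := S.le_opNorm _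
        _ ≤ ‖S‖ * (q ^ n * ‖u‖) := by gcongr
        _ = _ := by ring
  obtain ⟨u, hu⟩ : ∃ u, R u = x := ⟨_, hR.left_inv x⟩
  obtain ⟨x, hx⟩ := x
  dsimp only at hu
  subst hu
  have h1 : ⟪R u, B ⟨R u, hx⟩⟫_ℂ = ⟪S u, S (T u)⟫_ℂ := hRS u (T u)
  have h2 := hR.inner_self_eq u
  have h3 : (⟪R u, u⟫_ℂ).re = ‖S u‖ ^ 2 := by
    rw [hRS]
    exact inner_self_eq_norm_sq (𝕜 := ℂ) _
  rw [h1, ← h2, h3]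
  calc |(⟪S u, S (T u)⟫_ℂ).re| ≤ ‖⟪S u, S (T u)⟫_ℂ‖ := Complex.abs_re_le_norm _
    _ ≤ ‖S u‖ * ‖S (T u)‖ := norm_inner_le_norm _ _
    _ ≤ ‖S u‖ * (q * ‖S u‖) := by gcongr; exact key u
    _ = q * ‖S u‖ ^ 2 := by ring

variable {V : ℝ → A.domain →ₗ[ℂ] H}

theorem inner_perturbation_left (hA : IsSelfAdjoint A) (hsa : ∀ t, IsSelfAdjoint (hamiltonian A V t))
    (t : ℝ) (x y : A.domain) : ⟪V t x, (y : H)⟫_ℂ = ⟪(x : H), V t y⟫_ℂ := by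
  have h1 : ⟪A x + V t x, (y : H)⟫_ℂ = ⟪(x : H), A y + V t y⟫_ℂ :=
    inner_apply_left_of_isSelfAdjoint (hsa t) x y
  rw [inner_add_left, inner_add_right, inner_apply_left_of_isSelfAdjoint hA] at h1
  exact add_left_cancel h1

theorem UniformlyKatoBounded.exists_form_bound (hV : UniformlyKatoBounded A V)
    (hA : IsSelfAdjoint A) (hp : IsNonneg A) (hsa : ∀ t, IsSelfAdjoint (hamiltonian A V t)) :
    ∃ q K : ℝ, 0 ≤ q ∧ q < 1 ∧ ∀ (t : ℝ) (x : A.domain),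
      |(⟪(x : H), V t x⟫_ℂ).re| ≤ q * (⟪(x : H), A x⟫_ℂ).re + K * ‖(x : H)‖ ^ 2 := by
  obtain ⟨a, b, ha, hab⟩ := hV
  set a' := max a 0 with ha'
  set b' := max b 0 with hb'
  have ha1 : a' < 1 := max_lt ha one_pos
  have hb0 : 0 ≤ b' := le_max_right _ _
  -- Large enough that `b'/μ < 1 - a'`, so the relative form bound `a' + b'/μ` stays below `1`.
  set μ := 2 * b' / (1 - a') + 1 with hμ
  have h1a : 0 < 1 - a' := sub_pos.2 ha1
  have hμ0 : 0 < μ := by positivity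
  have hq : b' / μ < 1 - a' := by
    rw [div_lt_iff₀ hμ0, hμ, mul_add, mul_div_cancel₀ _ h1a.ne']
    linarith
  refine ⟨a' + b' / μ, (a' + b' / μ) * μ, ?_, by linarith, fun t x => ?_⟩
  · have : 0 ≤ a' := le_max_right _ _
    positivity
  · have := abs_inner_le_of_norm_le hA hp (B := V t) (inner_perturbation_left hA hsa t)
      (le_max_right a 0) hb0 (fun x => (hab t x).trans (by
        gcongr
        · exact le_max_left _ _
        · exact le_max_left _ _)) hμ0 x
    rw [mul_add, ← mul_assoc] at this
    exact this

end FormBound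

/-! ### Solutions of the perturbed equation -/

section Duhamel

/-- Only the majorant `k` has to be integrable; nothing is assumed on the measurability of `f'`. The
one-sided inequality is applied to `f` and to `-f`. -/
theorem abs_sub_le_integral_uIoc {f f' k : ℝ → ℝ} {a b : ℝ}
    (hf : ∀ t ∈ uIcc a b, HasDerivAt f (f' t) t) (hk : IntegrableOn k (uIcc a b))
    (hfk : ∀ t ∈ uIcc a b, |f' t| ≤ k t) : |f b - f a| ≤ ∫ t in uIoc a b, k t := by
  wlog hab : a ≤ b generalizing a b
  · rw [abs_sub_comm, uIoc_comm]
    rw [uIcc_comm] at hf hk hfk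
    exact this hf hk hfk (le_of_not_ge hab)
  rw [uIcc_of_le hab] at hf hk hfk
  rw [uIoc_of_le hab, ← intervalIntegral.integral_of_le hab]
  rw [abs_le']
  constructor
  · exact intervalIntegral.sub_le_integral_of_hasDeriv_right_of_le hab
      (fun t ht => (hf t ht).continuousAt.continuousWithinAt)
      (fun t ht => (hf t (Ioo_subset_Icc_self ht)).hasDerivWithinAt) hk
      fun t ht => (le_abs_self _).trans (hfk t (Ioo_subset_Icc_self ht))
  · have := intervalIntegral.sub_le_integral_of_hasDeriv_right_of_le (g := fun t => -f t)
      (g' := fun t => -f' t) hab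
      (fun t ht => (hf t ht).continuousAt.neg.continuousWithinAt)
      (fun t ht => (hf t (Ioo_subset_Icc_self ht)).neg.hasDerivWithinAt) hk
      fun t ht => (neg_le_abs _).trans (hfk t (Ioo_subset_Icc_self ht))
    linarith

namespace IsUnitaryPropagator

variable {U : ℝ → ℝ → H →L[ℂ] H}

theorem apply_apply (hU : IsUnitaryPropagator U) (t s r : ℝ) (x : H) :
    U t s (U s r x) = U t r x := by
  rw [← hU.mul t s r]
  rfl

theorem apply_self (hU : IsUnitaryPropagator U) (t : ℝ) (x : H) : U t t x = x := by
  rw [hU.self]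
  rfl

theorem norm_apply (hU : IsUnitaryPropagator U) (t s : ℝ) (x : H) : ‖U t s x‖ = ‖x‖ :=
  ContinuousLinearMap.norm_map_of_mem_unitary (hU.unitary t s) x

theorem inner_apply_left (hU : IsUnitaryPropagator U) (t s : ℝ) (x y : H) :
    ⟪U t s x, y⟫_ℂ = ⟪x, U s t y⟫_ℂ := by
  rw [← ContinuousLinearMap.inner_map_map_of_mem_unitary (hU.unitary t s) x, hU.apply_apply,
    hU.apply_self]

theorem adjoint_eq (hU : IsUnitaryPropagator U) (t s : ℝ) :
    ContinuousLinearMap.adjoint (U t s) = U s t := by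
  refine (ContinuousLinearMap.eq_adjoint_iff _ _).2 (fun x y => ?_) |>.symm
  exact hU.inner_apply_left s t x y

end IsUnitaryPropagator

variable {H₀ : H →ₗ.[ℂ] H} {V : ℝ → H₀.domain →ₗ[ℂ] H} {U : ℝ → ℝ → H →L[ℂ] H}

/-- `H(t) x = H₀ x + V_t x` for `x` in the domain of `H₀`. -/
def hamMap (V : ℝ → H₀.domain →ₗ[ℂ] H) (t : ℝ) (x : H₀.domain) : H := H₀ x + V t x

theorem inner_hamMap_left (hsa : ∀ t, IsSelfAdjoint (hamiltonian H₀ V t)) (t : ℝ)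
    (x y : H₀.domain) : ⟪hamMap V t x, (y : H)⟫_ℂ = ⟪(x : H), hamMap V t y⟫_ℂ :=
  inner_apply_left_of_isSelfAdjoint (hsa t) x y

/-- Duhamel's estimate for an approximate solution `φ` of the equation `i φ' = H(t) φ`. -/
theorem norm_sub_le_integral_uIoc (hA : IsSelfAdjoint H₀)
    (hsa : ∀ t, IsSelfAdjoint (hamiltonian H₀ V t))
    (hU : IsUnitaryPropagator U) (hUV : IsGeneratedBy H₀ V U) {φ g : ℝ → H} {k : ℝ → ℝ}
    (hφ : ∀ t, ∃ h : φ t ∈ H₀.domain,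
      HasDerivAt φ (-(Complex.I • hamMap V t ⟨φ t, h⟩) + g t) t)
    {a b : ℝ} (hk : IntegrableOn k (uIcc a b)) (hgk : ∀ t ∈ uIcc a b, ‖g t‖ ≤ k t) :
    ‖U 0 b (φ b) - U 0 a (φ a)‖ ≤ ∫ t in uIoc a b, k t := by
  set w := U 0 b (φ b) - U 0 a (φ a) with hw
  set K := ∫ t in uIoc a b, k t with hK
  -- Differentiating `U(0,t) φ(t)` directly would need regularity in the second time variable.
  -- Pairing `φ(t)` with `U(t,0) x`, for `x` in the domain, uses only the equation in the first;
  -- symmetry of `H(t)` cancels the Hamiltonian terms.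
  have h1 : ∀ x : H, |(⟪x, w⟫_ℂ).re| ≤ ‖x‖ * K := by
    intro x
    refine hA.dense_domain.induction (P := fun x => |(⟪x, w⟫_ℂ).re| ≤ ‖x‖ * K) ?_ ?_ x
    · intro x hx
      have hd : ∀ t, HasDerivAt (fun t => (⟪U t 0 x, φ t⟫_ℂ).re) (⟪U t 0 x, g t⟫_ℂ).re t := by
        intro t
        obtain ⟨hm, hd0⟩ := hUV t 0 ⟨x, hx⟩
        have hd1 : HasDerivAt (fun r : ℝ => U r 0 x)
          (-(Complex.I • hamMap V t ⟨U t 0 x, hm⟩)) t := hd0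
        obtain ⟨hm2, hd2⟩ := hφ t
        have h2 := Complex.reCLM.hasFDerivAt.comp_hasDerivAt t (hd1.inner ℂ hd2)
        refine h2.congr_deriv ?_
        have h3 : ⟪hamMap V t ⟨U t 0 x, hm⟩, φ t⟫_ℂ =
            ⟪U t 0 x, hamMap V t ⟨φ t, hm2⟩⟫_ℂ :=
          inner_hamMap_left hsa t ⟨U t 0 x, hm⟩ ⟨φ t, hm2⟩
        simp only [inner_add_right, inner_neg_left, inner_neg_right, inner_smul_left,
          inner_smul_right, Complex.conj_I, Complex.reCLM_apply]
        rw [h3]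
        congr 1
        ring
      have h4 := abs_sub_le_integral_uIoc (a := a) (b := b) (fun t _ => hd t)
        (hk.const_mul ‖x‖) (fun t ht => by
          refine (Complex.abs_re_le_norm _).trans ((norm_inner_le_norm _ _).trans ?_)
          rw [hU.norm_apply]
          gcongr
          exact hgk t ht)
      rw [integral_const_mul] at h4
      simp_rw [hU.inner_apply_left] at h4
      rw [hw, inner_sub_right]
      exact h4
    · exact isClosed_le (by fun_prop) (by fun_prop)
  have h2 := h1 w
  have h3 : (⟪w, w⟫_ℂ).re = ‖w‖ ^ 2 := inner_self_eq_norm_sq (𝕜 := ℂ) _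
  rw [h3, abs_of_nonneg (sq_nonneg _)] at h2
  have hK0 : 0 ≤ K := setIntegral_nonneg measurableSet_uIoc fun t ht =>
    (norm_nonneg _).trans (hgk t (uIoc_subset_uIcc ht))
  by_contra! hlt
  nlinarith [norm_nonneg w]

theorem HasBoundedTimeDeriv.exists_norm_sub_le (hV : HasBoundedTimeDeriv V) :
    ∃ M : ℝ, 0 ≤ M ∧ (∀ (t : ℝ) (x : H₀.domain), ‖timeDeriv V t x‖ ≤ M * ‖(x : H)‖) ∧
      ∀ (s t : ℝ) (x : H₀.domain), ‖V t x - V s x‖ ≤ M * ‖(x : H)‖ * |t - s| := by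
  obtain ⟨hd, M, hM⟩ := hV
  have hM' : ∀ (t : ℝ) (x : H₀.domain), ‖timeDeriv V t x‖ ≤ |M| * ‖(x : H)‖ := fun t x =>
    (hM t x).trans (by gcongr; exact le_abs_self M)
  refine ⟨|M|, abs_nonneg M, hM', fun s t x => ?_⟩
  exact convex_univ.norm_image_sub_le_of_norm_deriv_le (f := fun s => V s x) (fun r _ => hd x r)
    (fun r _ => hM' r x) (mem_univ s) (mem_univ t)

/-- `ψ` solves the equation `i ψ' = H(t) ψ`. -/
def IsSolution (H₀ : H →ₗ.[ℂ] H) (V : ℝ → H₀.domain →ₗ[ℂ] H) (ψ : ℝ → H) : Prop :=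
  ∀ t, ∃ h : ψ t ∈ H₀.domain, HasDerivAt ψ (-(Complex.I • hamMap V t ⟨ψ t, h⟩)) t

namespace IsSolution

variable {ψ : ℝ → H}

/-- Duhamel's estimate with zero error: solutions are unique and transported by `U`. -/
theorem apply_eq (hψ : IsSolution H₀ V ψ) (hA : IsSelfAdjoint H₀)
    (hsa : ∀ t, IsSelfAdjoint (hamiltonian H₀ V t))
    (hU : IsUnitaryPropagator U) (hUV : IsGeneratedBy H₀ V U) (s t : ℝ) :
    U 0 t (ψ t) = U 0 s (ψ s) := by
  have h := norm_sub_le_integral_uIoc hA hsa hU hUV (φ := ψ) (g := 0) (k := 0) (a := s) (b := t)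
    (fun r => by
      obtain ⟨h1, h2⟩ := hψ r
      exact ⟨h1, by simpa only [Pi.zero_apply, add_zero] using h2⟩)
    integrableOn_zero (by simp)
  simpa [sub_eq_zero] using h

theorem norm_eq (hψ : IsSolution H₀ V ψ) (hA : IsSelfAdjoint H₀)
    (hsa : ∀ t, IsSelfAdjoint (hamiltonian H₀ V t))
    (hU : IsUnitaryPropagator U) (hUV : IsGeneratedBy H₀ V U) (s t : ℝ) : ‖ψ t‖ = ‖ψ s‖ := by
  rw [← hU.norm_apply 0 t, hψ.apply_eq hA hsa hU hUV s t, hU.norm_apply]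

/-- `‖H(t)ψ(t)‖` is the limit of `‖ψ(t+δ) - ψ(t)‖/|δ|`. The translate `ψ(· + δ)` solves the original
equation up to the error `V_{r+δ} - V_r`, of norm at most `M|δ|` on the solution, so Duhamel
propagates the difference quotient from `s` to `t`. The result is a local bound on `H(t)ψ(t)`, whose
continuity in `t` is not available. -/
theorem norm_hamiltonian_le (hψ : IsSolution H₀ V ψ) (hA : IsSelfAdjoint H₀)
    (hsa : ∀ t, IsSelfAdjoint (hamiltonian H₀ V t))
    (hU : IsUnitaryPropagator U) (hUV : IsGeneratedBy H₀ V U) {M : ℝ}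
    (hM : ∀ (s t : ℝ) (x : H₀.domain), ‖V t x - V s x‖ ≤ M * ‖(x : H)‖ * |t - s|) (s t : ℝ) :
    ‖hamMap V t ⟨ψ t, (hψ t).1⟩‖ ≤
      ‖hamMap V s ⟨ψ s, (hψ s).1⟩‖ + M * ‖ψ s‖ * |t - s| := by
  have hn := hψ.norm_eq hA hsa hU hUV s
  have hdiff : ∀ δ : ℝ, ‖ψ (t + δ) - ψ t‖ ≤ ‖ψ (s + δ) - ψ s‖ + M * ‖ψ s‖ * |t - s| * |δ| := by
    intro δ
    have h1 := norm_sub_le_integral_uIoc hA hsa hU hUV (φ := fun r => ψ (r + δ))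
      (g := fun r => -(Complex.I • (V (r + δ) ⟨ψ (r + δ), (hψ (r + δ)).1⟩
        - V r ⟨ψ (r + δ), (hψ (r + δ)).1⟩)))
      (k := fun _ => M * ‖ψ s‖ * |δ|) (a := s) (b := t) ?_ ?_ ?_
    · rw [setIntegral_const, smul_eq_mul] at h1
      have hv : volume.real (uIoc s t) = |t - s| := by
        rw [Measure.real, uIoc, Real.volume_Ioc, max_sub_min_eq_abs, ENNReal.toReal_ofReal
          (abs_nonneg _)]
      rw [hv] at h1
      have h2 : ψ (t + δ) - ψ t = U t 0 ((U 0 t (ψ (t + δ)) - U 0 s (ψ (s + δ)))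
          + U 0 s (ψ (s + δ) - ψ s)) := by
        have h3 := hψ.apply_eq hA hsa hU hUV s t
        rw [map_sub (U 0 s), sub_add_sub_cancel, ← h3, map_sub, hU.apply_apply, hU.apply_apply,
          hU.apply_self, hU.apply_self]
      rw [h2, hU.norm_apply]
      refine (norm_add_le _ _).trans ?_
      rw [hU.norm_apply]
      linarith
    · intro r
      obtain ⟨h3, h4⟩ := hψ (r + δ)
      refine ⟨h3, (h4.comp_add_const r δ).congr_deriv ?_⟩
      rw [hamMap, hamMap, ← neg_add, ← smul_add]
      congr 2
      abel
    · exact integrableOn_const (by simp)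
    · intro r _
      rw [norm_neg, norm_smul, Complex.norm_I, one_mul]
      refine (hM r (r + δ) _).trans_eq ?_
      rw [add_sub_cancel_left]
      dsimp only
      rw [hn]
  have hlim : ∀ r, Tendsto (fun δ : ℝ => |δ|⁻¹ * ‖ψ (r + δ) - ψ r‖) (𝓝[≠] 0)
      (𝓝 ‖hamMap V r ⟨ψ r, (hψ r).1⟩‖) := by
    intro r
    have h1 := (hψ r).2.tendsto_slope_zero.norm
    simpa only [norm_smul, norm_neg, Complex.norm_I, one_mul, norm_inv, Real.norm_eq_abs] using h1
  refine le_of_tendsto_of_tendsto (hlim t) ((hlim s).add_const (M * ‖ψ s‖ * |t - s|)) ?_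
  filter_upwards [self_mem_nhdsWithin] with δ hδ
  have hδ' : 0 < |δ| := abs_pos.2 hδ
  calc |δ|⁻¹ * ‖ψ (t + δ) - ψ t‖
      ≤ |δ|⁻¹ * (‖ψ (s + δ) - ψ s‖ + M * ‖ψ s‖ * |t - s| * |δ|) := by gcongr; exact hdiff δ
    _ = _ := by field_simp

/-- The derivative of the energy `⟪ψ, H(t) ψ⟫` is `⟪ψ, (∂_t V_t) ψ⟫`. -/
theorem hasDerivAt_energy (hψ : IsSolution H₀ V ψ) (hA : IsSelfAdjoint H₀)
    (hsa : ∀ t, IsSelfAdjoint (hamiltonian H₀ V t)) (hV : HasBoundedTimeDeriv V)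
    (hU : IsUnitaryPropagator U) (hUV : IsGeneratedBy H₀ V U) (t : ℝ) :
    HasDerivAt (fun s => (⟪ψ s, hamMap V s ⟨ψ s, (hψ s).1⟩⟫_ℂ).re)
      (⟪ψ t, timeDeriv V t ⟨ψ t, (hψ t).1⟩⟫_ℂ).re t := by
  obtain ⟨M, hM0, -, hM⟩ := hV.exists_norm_sub_le
  set y := hamMap V t ⟨ψ t, (hψ t).1⟩ with hy
  set Y : ℝ → H := fun δ => hamMap V (t + δ) ⟨ψ (t + δ), (hψ (t + δ)).1⟩ with hY
  set σ : ℝ → H := fun δ => δ⁻¹ • (ψ (t + δ) - ψ t) with hσ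
  have hσl : Tendsto σ (𝓝[≠] 0) (𝓝 (-(Complex.I • y))) := (hψ t).2.tendsto_slope_zero
  have hτ : Tendsto (fun δ : ℝ => t + δ) (𝓝[≠] 0) (𝓝 t) := by
    have : Tendsto (fun δ : ℝ => t + δ) (𝓝 0) (𝓝 (t + 0)) :=
      (continuous_const.add continuous_id).tendsto 0
    rw [add_zero] at this
    exact this.mono_left nhdsWithin_le_nhds
  have hψl : Tendsto (fun δ => ψ (t + δ)) (𝓝[≠] 0) (𝓝 (ψ t)) :=
    (hψ t).2.continuousAt.tendsto.comp hτ
  set K := ‖y‖ + M * ‖ψ t‖ with hK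
  have hYb : ∀ᶠ δ in 𝓝[≠] (0 : ℝ), ‖Y δ‖ ≤ K := by
    have : ∀ᶠ δ in 𝓝[≠] (0 : ℝ), |δ| < 1 :=
      nhdsWithin_le_nhds (by
        have := Metric.ball_mem_nhds (0 : ℝ) one_pos
        simpa [Metric.ball, Real.dist_eq] using this)
    filter_upwards [this] with δ hδ
    have h1 := hψ.norm_hamiltonian_le hA hsa hU hUV hM t (t + δ)
    rw [add_sub_cancel_left] at h1
    refine h1.trans ?_
    exact add_le_add le_rfl (mul_le_of_le_one_right (by positivity) hδ.le)
  -- Weak convergence of `H(t+δ)ψ(t+δ)`: on domain vectors symmetry moves the Hamiltonian to the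
  -- fixed side, and the bound `K` extends it to all `z`.
  have hweak : ∀ z : H, Tendsto (fun δ => ⟪z, Y δ⟫_ℂ) (𝓝[≠] 0) (𝓝 ⟪z, y⟫_ℂ) := by
    intro z
    rw [Metric.tendsto_nhds]
    intro ε hε
    have hK0 : 0 ≤ K := by positivity
    obtain ⟨w, hw, hwd⟩ := Metric.dense_iff.1 hA.dense_domain z (ε / (3 * (K + 1))) (by positivity)
      |>.imp fun y hy => And.intro hy.2 hy.1
    rw [Metric.mem_ball, dist_comm, dist_eq_norm] at hwd
    have h1 : Tendsto (fun δ => ⟪w, Y δ⟫_ℂ) (𝓝[≠] 0) (𝓝 ⟪w, y⟫_ℂ) := by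
      have h2 : ∀ s (v : H₀.domain), ⟪w, hamMap V s v⟫_ℂ =
          ⟪H₀ ⟨w, hw⟩ + V s ⟨w, hw⟩, (v : H)⟫_ℂ := fun s v =>
        (inner_hamMap_left hsa s ⟨w, hw⟩ v).symm
      simp_rw [hY, hy, h2]
      exact ((((hV.1 ⟨w, hw⟩).continuous.tendsto t).comp hτ).const_add _).inner hψl
    have hwK : ‖z - w‖ * K ≤ ε / 3 := by
      rw [lt_div_iff₀ (by positivity)] at hwd
      nlinarith [norm_nonneg (z - w)]
    filter_upwards [hYb, Metric.tendsto_nhds.1 h1 (ε / 3) (by positivity)] with δ hδ1 hδ2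
    rw [dist_eq_norm] at hδ2 ⊢
    have h3 : ⟪z, Y δ⟫_ℂ - ⟪z, y⟫_ℂ =
        ⟪z - w, Y δ⟫_ℂ + (⟪w, Y δ⟫_ℂ - ⟪w, y⟫_ℂ) - ⟪z - w, y⟫_ℂ := by
      simp only [inner_sub_left]
      ring
    have h4 : ‖⟪z - w, Y δ⟫_ℂ‖ ≤ ε / 3 :=
      (norm_inner_le_norm _ _).trans ((mul_le_mul_of_nonneg_left hδ1 (norm_nonneg _)).trans hwK)
    have h5 : ‖⟪z - w, y⟫_ℂ‖ ≤ ε / 3 := by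
      refine (norm_inner_le_norm _ _).trans (le_trans ?_ hwK)
      gcongr
      rw [hK]
      have : 0 ≤ M * ‖ψ t‖ := by positivity
      linarith
    rw [h3]
    have h6 := norm_sub_le (⟪z - w, Y δ⟫_ℂ + (⟪w, Y δ⟫_ℂ - ⟪w, y⟫_ℂ)) ⟪z - w, y⟫_ℂ
    have h7 := norm_add_le ⟪z - w, Y δ⟫_ℂ (⟪w, Y δ⟫_ℂ - ⟪w, y⟫_ℂ)
    linarith
  have hVl : Tendsto (fun δ : ℝ => δ⁻¹ • (V (t + δ) ⟨ψ t, (hψ t).1⟩ - V t ⟨ψ t, (hψ t).1⟩))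
      (𝓝[≠] 0) (𝓝 (timeDeriv V t ⟨ψ t, (hψ t).1⟩)) :=
    (hV.1 ⟨ψ t, (hψ t).1⟩ t).hasDerivAt.tendsto_slope_zero
  rw [hasDerivAt_iff_tendsto_slope_zero]
  -- Symmetry arranges that `V` is differentiated only on the fixed vector `ψ t`, while `Y δ` occurs
  -- only paired with a vector tending to zero or with a constant one. Boundedness and weak
  -- convergence of `Y δ` therefore suffice, and the two Hamiltonian terms cancel in the limit.
  have hdecomp : ∀ δ : ℝ, δ⁻¹ • ((⟪ψ (t + δ), Y δ⟫_ℂ).re - (⟪ψ t, y⟫_ℂ).re) =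
      (⟪σ δ - -(Complex.I • y), Y δ⟫_ℂ + ⟪-(Complex.I • y), Y δ⟫_ℂ + ⟪y, σ δ⟫_ℂ
        + ⟪δ⁻¹ • (V (t + δ) ⟨ψ t, (hψ t).1⟩ - V t ⟨ψ t, (hψ t).1⟩), ψ (t + δ)⟫_ℂ).re := by
    intro δ
    rw [← inner_add_left, sub_add_cancel, ← Complex.sub_re, ← Complex.smul_re]
    congr 1
    rw [hσ]
    dsimp only
    simp_rw [← Complex.coe_smul, inner_smul_left, inner_smul_right, Complex.conj_ofReal, smul_eq_mul]
    rw [← mul_add, ← mul_add]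
    congr 1
    have h1 : ⟪ψ t, Y δ⟫_ℂ = ⟪H₀ ⟨ψ t, (hψ t).1⟩ + V (t + δ) ⟨ψ t, (hψ t).1⟩, ψ (t + δ)⟫_ℂ :=
      (inner_hamMap_left hsa (t + δ) ⟨ψ t, (hψ t).1⟩
        ⟨ψ (t + δ), (hψ (t + δ)).1⟩).symm
    have h2 : ⟪y, ψ t⟫_ℂ = ⟪ψ t, y⟫_ℂ :=
      inner_hamMap_left hsa t ⟨ψ t, (hψ t).1⟩ ⟨ψ t, (hψ t).1⟩
    have h3 : ⟪y, ψ (t + δ)⟫_ℂ = ⟪H₀ ⟨ψ t, (hψ t).1⟩ + V t ⟨ψ t, (hψ t).1⟩, ψ (t + δ)⟫_ℂ := rfl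
    rw [inner_sub_left, h1, inner_sub_right y, h2, h3]
    simp only [inner_sub_left, inner_add_left]
    ring
  have hT1 : Tendsto (fun δ => ⟪σ δ - -(Complex.I • y), Y δ⟫_ℂ) (𝓝[≠] 0) (𝓝 0) := by
    have h1 : Tendsto (fun δ => ‖σ δ - -(Complex.I • y)‖ * K) (𝓝[≠] 0) (𝓝 0) := by
      have := (tendsto_iff_norm_sub_tendsto_zero.1 hσl).mul_const K
      rwa [zero_mul] at this
    refine squeeze_zero_norm' ?_ h1
    filter_upwards [hYb] with δ hδ
    exact (norm_inner_le_norm _ _).trans (by gcongr)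
  have hlim := (((hT1.add (hweak (-(Complex.I • y)))).add
    (tendsto_const_nhds.inner hσl (x := y))).add (hVl.inner hψl))
  have hlim' := (Complex.continuous_re.tendsto _).comp hlim
  have hval : (0 + ⟪-(Complex.I • y), y⟫_ℂ + ⟪y, -(Complex.I • y)⟫_ℂ
      + ⟪timeDeriv V t ⟨ψ t, (hψ t).1⟩, ψ t⟫_ℂ).re =
      (⟪ψ t, timeDeriv V t ⟨ψ t, (hψ t).1⟩⟫_ℂ).re := by
    rw [inner_neg_left, inner_neg_right, inner_smul_left, inner_smul_right, Complex.conj_I]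
    have : (⟪timeDeriv V t ⟨ψ t, (hψ t).1⟩, ψ t⟫_ℂ).re =
      (⟪ψ t, timeDeriv V t ⟨ψ t, (hψ t).1⟩⟫_ℂ).re := inner_re_symm (𝕜 := ℂ) _ _
    rw [← this]
    congr 1
    ring
  rw [← hval]
  exact hlim'.congr fun δ => (hdecomp δ).symm

end IsSolution

end Duhamel

/-! ### Invariance of the domain and differentiation of the unitary group -/

section Group

namespace IsUnitaryGroupOf

variable {A : H →ₗ.[ℂ] H} {W : ℝ → H →L[ℂ] H}

theorem norm_apply (hW : IsUnitaryGroupOf A W) (t : ℝ) (x : H) : ‖W t x‖ = ‖x‖ :=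
  ContinuousLinearMap.norm_map_of_mem_unitary (hW.unitary t) x

theorem zero (hW : IsUnitaryGroupOf A W) : W 0 = 1 := by
  have h1 := hW.add 0 0
  rw [add_zero] at h1
  have h2 := (Unitary.mem_iff.1 (hW.unitary 0)).1
  calc W 0 = star (W 0) * W 0 * W 0 := by rw [h2, one_mul]
    _ = 1 := by rw [mul_assoc, ← h1, h2]

theorem add_apply (hW : IsUnitaryGroupOf A W) (s t : ℝ) (x : H) : W (s + t) x = W s (W t x) := by
  rw [hW.add]
  rfl

theorem exists_apply_eq (hW : IsUnitaryGroupOf A W) (t : ℝ) (x : A.domain) :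
    ∃ h : W t x ∈ A.domain, A ⟨W t x, h⟩ = W t (A x) := by
  rw [← mem_graph_iff_exists, hW.generator]
  have h1 := (hW.generator x (A x)).1 (mem_graph_iff_exists.2 ⟨x.2, rfl⟩)
  have h2 := ((W t).restrictScalars ℝ).hasFDerivAt.comp_hasDerivAt 0 h1
  have h3 : HasDerivAt (fun s => W s (W t x)) (W t (-(Complex.I • A x))) 0 := by
    refine h2.congr_of_eventuallyEq (Eventually.of_forall fun s => ?_)
    change W s (W t x) = W t (W s x)
    rw [← hW.add_apply, ← hW.add_apply, add_comm]
  simpa using h3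

theorem hasDerivAt (hW : IsUnitaryGroupOf A W) (t : ℝ) {x : H} (h : W t x ∈ A.domain) :
    HasDerivAt (fun s => W s x) (-(Complex.I • A ⟨W t x, h⟩)) t := by
  have h1 := (hW.generator (W t x) (A ⟨W t x, h⟩)).1 (mem_graph_iff_exists.2 ⟨h, rfl⟩)
  rw [← sub_self t] at h1
  have h2 := h1.comp_sub_const t t
  simp_rw [← hW.add_apply, sub_add_cancel] at h2
  exact h2

end IsUnitaryGroupOf

end Group

/-! ### Cook's estimate and the uniform kinetic energy bound -/

section Scattering

variable {H₀ : H →ₗ.[ℂ] H} {V : ℝ → H₀.domain →ₗ[ℂ] H} {U : ℝ → ℝ → H →L[ℂ] H}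

/-- Cook's estimate. -/
theorem norm_sub_le_integral_of_decay (hA : IsSelfAdjoint H₀) (hp : IsNonneg H₀)
    (hsa : ∀ t, IsSelfAdjoint (hamiltonian H₀ V t))
    (hU : IsUnitaryPropagator U) (hUV : IsGeneratedBy H₀ V U) {x : H} {k : ℝ → ℝ}
    (hk : Integrable k)
    (hdec : ∀ t, ∃ hx : expGroup H₀ t x ∈ H₀.domain, ‖V t ⟨expGroup H₀ t x, hx⟩‖ ≤ k t) (a b : ℝ) :
    ‖U 0 b (expGroup H₀ b x) - U 0 a (expGroup H₀ a x)‖ ≤ ∫ t in uIoc a b, k t := by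
  have hW := isUnitaryGroupOf_expGroup hA hp
  choose hx hkx using hdec
  refine norm_sub_le_integral_uIoc hA hsa hU hUV (φ := fun t => expGroup H₀ t x)
    (g := fun t => Complex.I • V t ⟨expGroup H₀ t x, hx t⟩) (fun t => ⟨hx t, ?_⟩)
    hk.integrableOn (fun t _ => ?_)
  · refine (hW.hasDerivAt t (hx t)).congr_deriv ?_
    rw [hamMap, smul_add]
    abel
  · rw [norm_smul, Complex.norm_I, one_mul]
    exact hkx t

/-- Between `s` and `T` one only moves away from `0`, so the weight `1/(1+|r|)` may be replaced by
`1/(1+|s|)`. -/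
theorem abs_le_abs_of_mem_uIoc {s r T : ℝ} (hs : s ∈ uIcc 0 T) (hr : r ∈ uIoc s T) :
    |s| ≤ |r| := by
  rw [mem_uIcc] at hs
  rw [mem_uIoc] at hr
  rcases hs with hs | hs <;> rcases hr with hr | hr
  · exact abs_le_abs_of_nonneg hs.1 hr.1.le
  · linarith
  · linarith
  · rw [abs_of_nonpos hs.2, abs_of_nonpos (hr.2.trans hs.2)]
    linarith

theorem integrable_div_one_add_abs {h : ℝ → ℝ} (hh : Integrable h) :
    Integrable fun t => h t / (1 + |t|) := by
  have : (fun t => h t / (1 + |t|)) = fun t => (1 + |t|)⁻¹ * h t := by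
    funext t
    rw [div_eq_inv_mul]
  rw [this]
  refine hh.bdd_mul (c := 1) ?_ (Eventually.of_forall fun t => ?_)
  · refine Continuous.aestronglyMeasurable ?_
    exact (continuous_const.add continuous_abs).inv₀ fun t =>
      (show (0 : ℝ) < 1 + |t| by positivity).ne'
  · rw [norm_inv, Real.norm_of_nonneg (by positivity)]
    exact inv_le_one_of_one_le₀ (by linarith [abs_nonneg t])

/-- Lets both cross terms of `⟪w + δ, (∂_t V_t)(w + δ)⟫` be written with `∂_t V_t` acting on `w`. -/
theorem inner_timeDeriv_left (hA : IsSelfAdjoint H₀)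
    (hsa : ∀ t, IsSelfAdjoint (hamiltonian H₀ V t)) (hV : HasBoundedTimeDeriv V) (t : ℝ)
    (x y : H₀.domain) : ⟪timeDeriv V t x, (y : H)⟫_ℂ = ⟪(x : H), timeDeriv V t y⟫_ℂ := by
  have h1 : HasDerivAt (fun s => ⟪V s x, (y : H)⟫_ℂ) ⟪timeDeriv V t x, (y : H)⟫_ℂ t :=
    ((hV.1 x t).hasDerivAt.inner ℂ (hasDerivAt_const t (y : H))).congr_deriv
      (by rw [inner_zero_right, zero_add]; rfl)
  have h2 : HasDerivAt (fun s => ⟪(x : H), V s y⟫_ℂ) ⟪(x : H), timeDeriv V t y⟫_ℂ t :=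
    ((hasDerivAt_const t (x : H)).inner ℂ (hV.1 y t).hasDerivAt).congr_deriv
      (by rw [inner_zero_left, add_zero]; rfl)
  simp_rw [inner_perturbation_left hA hsa] at h1
  exact h1.unique h2

theorem timeDeriv_add (hV : HasBoundedTimeDeriv V) (t : ℝ) (x y : H₀.domain) :
    timeDeriv V t (x + y) = timeDeriv V t x + timeDeriv V t y := by
  have h := (hV.1 x t).hasDerivAt.add (hV.1 y t).hasDerivAt
  have h2 : timeDeriv V t (x + y) = _ := (h.congr_of_eventuallyEq
    (Eventually.of_forall fun s => map_add (V s) x y)).deriv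
  exact h2

/-- Splitting a vector as `w + δ` bounds the expectation of `∂_t V_t` by first order terms
involving `(∂_t V_t) w` and a term quadratic in `δ`. -/
theorem abs_inner_timeDeriv_le (hA : IsSelfAdjoint H₀)
    (hsa : ∀ t, IsSelfAdjoint (hamiltonian H₀ V t)) (hV : HasBoundedTimeDeriv V) {M : ℝ}
    (hM : ∀ (t : ℝ) (x : H₀.domain), ‖timeDeriv V t x‖ ≤ M * ‖(x : H)‖) (t : ℝ)
    (v w : H₀.domain) :
    |(⟪(v : H), timeDeriv V t v⟫_ℂ).re| ≤
      (2 * ‖(v : H)‖ + ‖(w : H)‖) * ‖timeDeriv V t w‖ + M * ‖(v : H) - w‖ ^ 2 := by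
  obtain ⟨δ, rfl⟩ : ∃ δ, v = w + δ := ⟨v - w, by abel⟩
  have h1 : ⟪((w + δ : H₀.domain) : H), timeDeriv V t (w + δ)⟫_ℂ =
      ⟪((w + δ : H₀.domain) : H), timeDeriv V t w⟫_ℂ + ⟪timeDeriv V t w, (δ : H)⟫_ℂ
        + ⟪(δ : H), timeDeriv V t δ⟫_ℂ := by
    rw [timeDeriv_add hV, inner_timeDeriv_left hA hsa hV, inner_add_right]
    have : ((w + δ : H₀.domain) : H) = (w : H) + δ := rfl
    rw [this, inner_add_left _ _ (timeDeriv V t δ)]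
    ring
  have h2 : ((w + δ : H₀.domain) : H) - w = δ := by simp
  rw [h1, h2]
  have h3 : ‖(δ : H)‖ ≤ ‖((w + δ : H₀.domain) : H)‖ + ‖(w : H)‖ := by
    rw [← h2]
    exact norm_sub_le _ _
  refine (Complex.abs_re_le_norm _).trans ((norm_add₃_le).trans ?_)
  have h4 := norm_inner_le_norm (𝕜 := ℂ) ((w + δ : H₀.domain) : H) (timeDeriv V t w)
  have h5 := norm_inner_le_norm (𝕜 := ℂ) (timeDeriv V t w) (δ : H)
  have h6 := norm_inner_le_norm (𝕜 := ℂ) (δ : H) (timeDeriv V t δ)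
  have h7 := mul_le_mul_of_nonneg_left (hM t δ) (norm_nonneg (δ : H))
  have h8 := mul_le_mul_of_nonneg_left h3 (norm_nonneg (timeDeriv V t w))
  linarith

/-- The kinetic energy of the evolution at time `t` that agrees with the free evolution at time
`T` is bounded uniformly in `T` and in `t` between `0` and `T`. -/
theorem exists_kinetic_energy_bound (hA : IsSelfAdjoint H₀) (hp : IsNonneg H₀)
    (hsa : ∀ t, IsSelfAdjoint (hamiltonian H₀ V t)) (hKato : UniformlyKatoBounded H₀ V)
    (hV : HasBoundedTimeDeriv V) (hU : IsUnitaryPropagator U) (hUV : IsGeneratedBy H₀ V U)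
    {x : H} {h : ℝ → ℝ} (hh : Integrable h)
    (hdec : ∀ t : ℝ, ∃ hx : expGroup H₀ t x ∈ H₀.domain,
        ‖V t ⟨expGroup H₀ t x, hx⟩‖ ≤ h t / (1 + |t|) ∧
        ‖timeDeriv V t ⟨expGroup H₀ t x, hx⟩‖ ≤ h t) :
    ∃ C : ℝ, ∀ T, ∀ t ∈ uIcc 0 T, ∃ hm : U t T (expGroup H₀ T x) ∈ H₀.domain,
      (⟪U t T (expGroup H₀ T x), H₀ ⟨_, hm⟩⟫_ℂ).re ≤ C := by
  have hW := isUnitaryGroupOf_expGroup hA hp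
  set W := expGroup H₀ with hWdef
  choose hx hk1 hk2 using hdec
  have hx0 : x ∈ H₀.domain := by simpa [hW.zero] using hx 0
  have h0 : ∀ t, 0 ≤ h t := fun t => (norm_nonneg _).trans (hk2 t)
  obtain ⟨M, hM0, hM, -⟩ := hV.exists_norm_sub_le
  obtain ⟨q, K, hq0, hq1, hqK⟩ := hKato.exists_form_bound hA hp hsa
  set J := ∫ t, h t with hJ
  have hJ0 : 0 ≤ J := integral_nonneg h0
  -- Majorant of the energy's rate of change: `3‖x‖` is `2‖ψ‖ + ‖W s x‖`, and the second term comes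
  -- from `M‖δ‖²` with `‖δ‖ ≤ J/(1+|s|)`.
  set k : ℝ → ℝ := fun s => 3 * ‖x‖ * h s + M * J ^ 2 * (1 + s ^ 2)⁻¹ with hk
  have hkint : Integrable k := (hh.const_mul _).add (integrable_inv_one_add_sq.const_mul _)
  have hk0 : ∀ s, 0 ≤ k s := fun s => by
    have := h0 s
    positivity
  set e := (⟪x, H₀ ⟨x, hx0⟩⟫_ℂ).re with he
  -- The form bound is used twice: at `t` it gives `(1-q)⟪ψ, H₀ψ⟫ ≤ energy + K‖x‖²`, and at `T` it
  -- bounds the energy by `(1+q)e + K‖x‖²`. In between the energy changes by at most `∫ k`.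
  refine ⟨((1 + q) * e + 2 * K * ‖x‖ ^ 2 + ∫ s, k s) / (1 - q), fun T t ht => ?_⟩
  set ψ : ℝ → H := fun s => U s T (W T x) with hψdef
  have hψ : IsSolution H₀ V ψ := fun s => hUV s T ⟨W T x, hx T⟩
  have hψn : ∀ s, ‖ψ s‖ = ‖x‖ := fun s => by rw [hψdef]; simp only [hU.norm_apply, hW.norm_apply]
  have hδ : ∀ s ∈ uIcc 0 T, ‖ψ s - W s x‖ ≤ J / (1 + |s|) := by
    intro s hs
    have h1 := norm_sub_le_integral_of_decay hA hp hsa hU hUV (integrable_div_one_add_abs hh)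
      (fun t => ⟨hx t, hk1 t⟩) s T
    have h2 : ‖ψ s - W s x‖ = ‖U 0 T (W T x) - U 0 s (W s x)‖ := by
      rw [← hU.norm_apply 0 s, map_sub, hU.apply_apply]
    rw [h2]
    refine h1.trans ?_
    have h3 : ∫ r in uIoc s T, h r / (1 + |r|) ≤ ∫ r in uIoc s T, h r / (1 + |s|) := by
      refine setIntegral_mono_on (integrable_div_one_add_abs hh).integrableOn
        (hh.div_const _).integrableOn measurableSet_uIoc fun r hr => ?_
      have := abs_le_abs_of_mem_uIoc hs hr
      have := h0 r
      gcongr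
    refine h3.trans ?_
    rw [integral_div]
    gcongr
    exact setIntegral_le_integral hh (Eventually.of_forall h0)
  have hrate : ∀ s ∈ uIcc T t, |(⟪ψ s, timeDeriv V s ⟨ψ s, (hψ s).1⟩⟫_ℂ).re| ≤ k s := by
    intro s hs
    have hs' : s ∈ uIcc 0 T := uIcc_subset_uIcc right_mem_uIcc ht hs
    have h1 := abs_inner_timeDeriv_le hA hsa hV hM s ⟨ψ s, (hψ s).1⟩ ⟨W s x, hx s⟩
    refine h1.trans ?_
    dsimp only
    rw [hψn, hW.norm_apply, hk]
    dsimp only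
    have h2 : ‖ψ s - W s x‖ ^ 2 ≤ J ^ 2 * (1 + s ^ 2)⁻¹ := by
      calc ‖ψ s - W s x‖ ^ 2 ≤ (J / (1 + |s|)) ^ 2 := by gcongr; exact hδ s hs'
        _ = J ^ 2 * ((1 + |s|) ^ 2)⁻¹ := by rw [div_pow, div_eq_mul_inv]
        _ ≤ J ^ 2 * (1 + s ^ 2)⁻¹ := by
          gcongr
          nlinarith [sq_abs s, abs_nonneg s]
    have h3 : (2 * ‖x‖ + ‖x‖) * ‖timeDeriv V s ⟨W s x, hx s⟩‖ ≤ 3 * ‖x‖ * h s := by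
      have := mul_le_mul_of_nonneg_left (hk2 s) (show 0 ≤ 3 * ‖x‖ by positivity)
      linarith
    have h4 := mul_le_mul_of_nonneg_left h2 hM0
    linarith
  have henergy := abs_sub_le_integral_uIoc
    (fun s _ => hψ.hasDerivAt_energy hA hsa hV hU hUV s) hkint.integrableOn hrate
  have henergy' := henergy.trans (setIntegral_le_integral hkint (Eventually.of_forall hk0))
  have hsplit : ∀ (s : ℝ) (v : H₀.domain), (⟪(v : H), hamMap V s v⟫_ℂ).re =
      (⟪(v : H), H₀ v⟫_ℂ).re + (⟪(v : H), V s v⟫_ℂ).re := fun s v => by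
    rw [hamMap, inner_add_right, Complex.add_re]
  have h1 := hsplit t ⟨ψ t, (hψ t).1⟩
  have h2 := hsplit T ⟨ψ T, (hψ T).1⟩
  have h3 := hqK t ⟨ψ t, (hψ t).1⟩
  have h4 := hqK T ⟨ψ T, (hψ T).1⟩
  dsimp only at h1 h2 h3 h4
  have h5 : (⟪ψ T, H₀ ⟨ψ T, (hψ T).1⟩⟫_ℂ).re = e := by
    obtain ⟨h6, h7⟩ := hW.exists_apply_eq T ⟨x, hx0⟩
    have h8 : ψ T = W T x := by rw [hψdef]; simp only [hU.apply_self]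
    simp_rw [h8]
    dsimp only at h7
    rw [h7, ContinuousLinearMap.inner_map_map_of_mem_unitary (hW.unitary T)]
  refine ⟨(hψ t).1, ?_⟩
  change (⟪ψ t, H₀ ⟨ψ t, (hψ t).1⟩⟫_ℂ).re ≤ _
  rw [le_div_iff₀ (by linarith)]
  rw [h1, h2, h5] at henergy'
  rw [hψn] at h3 h4
  rw [h5] at h4
  have h6 := (abs_le.1 henergy').2
  have h7 := (abs_le.1 h3).1
  have h8 := (abs_le.1 h4).2
  linarith

end Scattering

/-! ### Representations of `C(X, ℝ)` and projection-valued measures -/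

section Representation

variable {X : Type*} [MetricSpace X] [CompactSpace X] [MeasurableSpace X] [BorelSpace X]
variable (π : C(X, ℝ) →⋆ₐ[ℝ] (H →L[ℂ] H))

theorem inner_representation_left (f : C(X, ℝ)) (x y : H) : ⟪π f x, y⟫_ℂ = ⟪x, π f y⟫_ℂ := by
  have h : star (π f) = π f := by rw [← map_star, star_trivial]
  conv_rhs => rw [← h, ContinuousLinearMap.star_eq_adjoint]
  rw [ContinuousLinearMap.adjoint_inner_right]

theorem representation_mul_apply (f g : C(X, ℝ)) (x : H) : π (f * g) x = π f (π g x) := by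
  rw [map_mul]
  rfl

theorem norm_sq_representation (f : C(X, ℝ)) (x : H) :
    ‖π f x‖ ^ 2 = (⟪x, π (f * f) x⟫_ℂ).re := by
  rw [representation_mul_apply, ← inner_representation_left]
  exact (inner_self_eq_norm_sq (𝕜 := ℂ) _).symm

open CompactlySupported in
-- Riesz–Markov: the functional is positive because a nonnegative `f` is `g * g` with `g = √f`,
-- which makes it `‖π g x‖²`.
theorem exists_measure_integral_eq (x : H) : ∃ ν : Measure X, IsFiniteMeasure ν ∧
    ∀ f : C(X, ℝ), ∫ k, f k ∂ν = (⟪x, π f x⟫_ℂ).re := by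
  let L : C_c(X, ℝ) →ₗ[ℝ] ℝ :=
    { toFun := fun f => (⟪x, π f.toContinuousMap x⟫_ℂ).re
      map_add' := fun f g => by
        have : (f + g).toContinuousMap = f.toContinuousMap + g.toContinuousMap := rfl
        rw [this, map_add, ← Complex.add_re, ← inner_add_right]
        rfl
      map_smul' := fun c f => by
        have : (c • f).toContinuousMap = c • f.toContinuousMap := rfl
        rw [this, map_smul]
        change (⟪x, c • π f.toContinuousMap x⟫_ℂ).re = _
        rw [← Complex.coe_smul, inner_smul_right, Complex.re_ofReal_mul]
        rfl }
  have hL : ∀ f : C_c(X, ℝ), 0 ≤ f → 0 ≤ L f := by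
    intro f hf
    let g : C(X, ℝ) := ⟨fun k => √(f k), by fun_prop⟩
    have hg : g * g = f.toContinuousMap := by
      ext k
      exact Real.mul_self_sqrt (hf k)
    change 0 ≤ (⟪x, π f.toContinuousMap x⟫_ℂ).re
    rw [← hg, ← norm_sq_representation]
    positivity
  let Λ : C_c(X, ℝ) →ₚ[ℝ] ℝ := PositiveLinearMap.mk₀ L hL
  have hfin : IsFiniteMeasureOnCompacts (RealRMK.rieszMeasure Λ) := inferInstance
  refine ⟨RealRMK.rieszMeasure Λ, ⟨hfin.lt_top_of_isCompact isCompact_univ⟩, fun f => ?_⟩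
  exact RealRMK.integral_rieszMeasure Λ ⟨f, HasCompactSupport.of_compactSpace f⟩

/-- The measure `ν` with `∫ f dν = ⟪x, π(f) x⟫`. -/
def repMeasure (x : H) : Measure X := (exists_measure_integral_eq π x).choose

instance (x : H) : IsFiniteMeasure (repMeasure π x) :=
  (exists_measure_integral_eq π x).choose_spec.1

theorem integral_repMeasure (x : H) (f : C(X, ℝ)) :
    ∫ k, f k ∂(repMeasure π x) = (⟪x, π f x⟫_ℂ).re :=
  (exists_measure_integral_eq π x).choose_spec.2 f

theorem integral_sq_repMeasure (x : H) (f : C(X, ℝ)) :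
    ∫ k, f k ^ 2 ∂(repMeasure π x) = ‖π f x‖ ^ 2 := by
  rw [norm_sq_representation, ← integral_repMeasure]
  simp only [ContinuousMap.mul_apply, sq]

theorem repMeasure_real_univ (x : H) : (repMeasure π x).real univ = ‖x‖ ^ 2 := by
  have h := integral_sq_repMeasure π x 1
  rw [map_one] at h
  simpa using h

theorem integrable_continuousMap (μ : Measure X) [IsFiniteMeasure μ] (f : C(X, ℝ)) :
    Integrable (fun k => f k) μ :=
  f.continuous.integrable_of_hasCompactSupport (HasCompactSupport.of_compactSpace f)

theorem measure_eq_of_forall_integral_eq {μ ν : Measure X} [IsFiniteMeasure μ] [IsFiniteMeasure ν]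
    (h : ∀ f : C(X, ℝ), ∫ k, f k ∂μ = ∫ k, f k ∂ν) : μ = ν :=
  ext_of_forall_integral_eq_of_IsFiniteMeasure fun f => h f.toContinuousMap

/-- A sequence of continuous functions with values in `[0, 1]` that converges to the indicator
function of `S` in `L¹(μ)`. -/
structure ApproxIndicator (μ : Measure X) (S : Set X) (f : ℕ → C(X, ℝ)) : Prop where
  nonneg : ∀ n k, 0 ≤ f n k
  le_one : ∀ n k, f n k ≤ 1
  tendsto : Tendsto (fun n => ∫ k, |f n k - S.indicator 1 k| ∂μ) atTop (𝓝 0)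

theorem indicator_one_mem (S : Set X) (k : X) :
    0 ≤ S.indicator (1 : X → ℝ) k ∧ S.indicator (1 : X → ℝ) k ≤ 1 := by
  by_cases h : k ∈ S <;> simp [h]

theorem integrable_indicator_one (μ : Measure X) [IsFiniteMeasure μ] {S : Set X}
    (hS : MeasurableSet S) : Integrable (S.indicator (1 : X → ℝ)) μ :=
  (integrable_const (1 : ℝ)).indicator hS

theorem integrable_abs_sub_indicator_one (μ : Measure X) [IsFiniteMeasure μ] (f : C(X, ℝ))
    {S : Set X} (hS : MeasurableSet S) : Integrable (fun k => |f k - S.indicator 1 k|) μ :=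
  ((integrable_continuousMap μ f).sub (integrable_indicator_one μ hS)).abs

/-- Continuous functions are dense in `L¹`, and clipping to `[0,1]` does not increase the distance
to an indicator. -/
theorem exists_approxIndicator (μ : Measure X) [IsFiniteMeasure μ] {S : Set X}
    (hS : MeasurableSet S) : ∃ f, ApproxIndicator μ S f := by
  have h : ∀ n : ℕ, ∃ g : C(X, ℝ), (∀ k, 0 ≤ g k) ∧ (∀ k, g k ≤ 1) ∧
      ∫ k, |g k - S.indicator 1 k| ∂μ ≤ 1 / ((n : ℝ) + 1) := by
    intro n
    obtain ⟨g, hg, -⟩ := (integrable_indicator_one μ hS).exists_boundedContinuous_integral_sub_le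
      (one_div_succ_pos n)
    let g' : C(X, ℝ) := ⟨fun k => max 0 (min 1 (g k)), by fun_prop⟩
    refine ⟨g', fun k => le_max_left _ _, fun k => max_le zero_le_one (min_le_left _ _), ?_⟩
    refine le_trans (integral_mono ?_ ?_ fun k => ?_) hg
    · exact integrable_abs_sub_indicator_one μ g' hS
    · exact ((integrable_indicator_one μ hS).sub
        (integrable_continuousMap μ g.toContinuousMap)).norm
    · obtain ⟨h1, h2⟩ := indicator_one_mem S k
      change |max 0 (min 1 (g k)) - _| ≤ ‖_ - g k‖
      rw [Real.norm_eq_abs, abs_sub_comm]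
      have h3 : S.indicator (1 : X → ℝ) k = max 0 (min 1 (S.indicator 1 k)) := by
        rw [min_eq_right h2, max_eq_right h1]
      conv_lhs => rw [h3]
      refine (abs_max_sub_max_le_max (0 : ℝ) _ 0 _).trans (max_le (by simp) ?_)
      exact (abs_min_sub_min_le_max (1 : ℝ) _ 1 _).trans (by simp)
  choose f h0 h1 hf using h
  exact ⟨f, h0, h1, squeeze_zero (fun _ => integral_nonneg fun _ => abs_nonneg _) hf
    tendsto_one_div_add_atTop_nhds_zero_nat⟩

namespace ApproxIndicator

variable {μ : Measure X} [IsFiniteMeasure μ] {S T : Set X} {f g : ℕ → C(X, ℝ)}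

theorem mono {ν : Measure X} (hf : ApproxIndicator μ S f) (hS : MeasurableSet S) (h : ν ≤ μ) :
    ApproxIndicator ν S f :=
  ⟨hf.nonneg, hf.le_one, squeeze_zero (fun _ => integral_nonneg fun _ => abs_nonneg _)
    (fun n => integral_mono_measure h (Eventually.of_forall fun _ => abs_nonneg _)
      (integrable_abs_sub_indicator_one μ (f n) hS)) hf.tendsto⟩

theorem tendsto_integral (hf : ApproxIndicator μ S f) (hS : MeasurableSet S) :
    Tendsto (fun n => ∫ k, f n k ∂μ) atTop (𝓝 (μ.real S)) := by
  rw [tendsto_iff_norm_sub_tendsto_zero]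
  refine squeeze_zero (fun n => norm_nonneg _) (fun n => ?_) hf.tendsto
  have h : μ.real S = ∫ k, S.indicator (1 : X → ℝ) k ∂μ := (integral_indicator_one hS).symm
  rw [h, ← integral_sub (integrable_continuousMap μ (f n)) (integrable_indicator_one μ hS)]
  exact norm_integral_le_integral_norm _

theorem mul (hf : ApproxIndicator μ S f) (hg : ApproxIndicator μ T g) (hS : MeasurableSet S)
    (hT : MeasurableSet T) : ApproxIndicator μ (S ∩ T) fun n => f n * g n := by
  refine ⟨fun n k => mul_nonneg (hf.nonneg n k) (hg.nonneg n k),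
    fun n k => mul_le_one₀ (hf.le_one n k) (hg.nonneg n k) (hg.le_one n k), ?_⟩
  have h := hf.tendsto.add hg.tendsto
  rw [add_zero] at h
  refine squeeze_zero (fun _ => integral_nonneg fun _ => abs_nonneg _) (fun n => ?_) h
  have hi1 := integrable_abs_sub_indicator_one μ (f n) hS
  have hi2 := integrable_abs_sub_indicator_one μ (g n) hT
  rw [← integral_add hi1 hi2]
  refine integral_mono (integrable_abs_sub_indicator_one μ (f n * g n) (hS.inter hT)) (hi1.add hi2) fun k => ?_
  dsimp only
  rw [Set.inter_indicator_one, Pi.mul_apply, ContinuousMap.mul_apply]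
  have h1 : f n k * g n k - S.indicator (1 : X → ℝ) k * T.indicator (1 : X → ℝ) k =
      (f n k - S.indicator 1 k) * g n k + S.indicator 1 k * (g n k - T.indicator 1 k) := by ring
  rw [h1]
  refine (abs_add_le _ _).trans ?_
  rw [abs_mul, abs_mul, abs_of_nonneg (hg.nonneg n k), abs_of_nonneg (indicator_one_mem S k).1]
  exact add_le_add (mul_le_of_le_one_right (abs_nonneg _) (hg.le_one n k))
    (mul_le_of_le_one_left (abs_nonneg _) (indicator_one_mem S k).2)

/-- Two functions with values in `[0,1]` differ by at most `1`, so their squared difference is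
bounded by the difference: `L¹` closeness gives `L²` closeness, the norm in which `f ↦ π f x` is
isometric. -/
theorem integral_sub_sq_le (hf : ApproxIndicator μ S f) (hg : ApproxIndicator μ S g)
    (hS : MeasurableSet S) (n m : ℕ) :
    ∫ k, (f n - g m) k ^ 2 ∂μ ≤
      ∫ k, |f n k - S.indicator 1 k| ∂μ + ∫ k, |g m k - S.indicator 1 k| ∂μ := by
  have hi1 := integrable_abs_sub_indicator_one μ (f n) hS
  have hi2 := integrable_abs_sub_indicator_one μ (g m) hS
  rw [← integral_add hi1 hi2]
  refine integral_mono (integrable_continuousMap μ ((f n - g m) ^ 2)) (hi1.add hi2) fun k => ?_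
  dsimp only
  rw [ContinuousMap.sub_apply]
  have h1 : |f n k - g m k| ≤ 1 := by
    rw [abs_le]
    constructor <;> linarith [hf.nonneg n k, hf.le_one n k, hg.nonneg m k, hg.le_one m k]
  have h2 := abs_sub_le (f n k) (S.indicator 1 k) (g m k)
  rw [abs_sub_comm (S.indicator 1 k) (g m k)] at h2
  rw [← sq_abs]
  change _ ≤ |f n k - S.indicator 1 k| + |g m k - S.indicator 1 k|
  nlinarith [abs_nonneg (f n k - g m k)]

end ApproxIndicator

theorem norm_sq_representation_sub_le {x : H} {S : Set X} (hS : MeasurableSet S)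
    {f g : ℕ → C(X, ℝ)} (hf : ApproxIndicator (repMeasure π x) S f)
    (hg : ApproxIndicator (repMeasure π x) S g) (n m : ℕ) : ‖π (f n) x - π (g m) x‖ ^ 2 ≤
      ∫ k, |f n k - S.indicator 1 k| ∂(repMeasure π x)
        + ∫ k, |g m k - S.indicator 1 k| ∂(repMeasure π x) := by
  have h := hf.integral_sub_sq_le hg hS n m
  rw [integral_sq_repMeasure, map_sub] at h
  exact h

/-- By the isometry `‖π f x‖² = ∫ f² dν` the approximants are Cauchy, and any two approximating
sequences have the same limit. This independence is what later yields linearity in `x` and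
multiplicativity in `S`. -/
theorem exists_tendsto_representation (x : H) {S : Set X} (hS : MeasurableSet S) :
    ∃ y, ∀ f, ApproxIndicator (repMeasure π x) S f →
      Tendsto (fun n => π (f n) x) atTop (𝓝 y) := by
  obtain ⟨f, hf⟩ := exists_approxIndicator (repMeasure π x) hS
  have hc : CauchySeq fun n => π (f n) x := by
    rw [Metric.cauchySeq_iff]
    intro ε hε
    obtain ⟨N, hN⟩ := Metric.tendsto_atTop.1 hf.tendsto (ε ^ 2 / 2) (by positivity)
    refine ⟨N, fun m hm n hn => ?_⟩
    have h1 := norm_sq_representation_sub_le π hS hf hf m n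
    have h2 := hN m hm
    have h3 := hN n hn
    rw [Real.dist_0_eq_abs] at h2 h3
    have h4 := (le_abs_self _).trans_lt h2
    have h5 := (le_abs_self _).trans_lt h3
    rw [dist_eq_norm]
    exact lt_of_pow_lt_pow_left₀ 2 hε.le (by linarith)
  obtain ⟨y, hy⟩ := cauchySeq_tendsto_of_complete hc
  refine ⟨y, fun g hg => ?_⟩
  have h1 : Tendsto (fun n => π (g n) x - π (f n) x) atTop (𝓝 0) := by
    have h2 := hg.tendsto.add hf.tendsto
    rw [add_zero] at h2
    have h3 := squeeze_zero (fun n => sq_nonneg _)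
      (fun n => norm_sq_representation_sub_le π hS hg hf n n) h2
    have h4 := h3.sqrt
    simp_rw [Real.sqrt_sq (norm_nonneg _), Real.sqrt_zero] at h4
    exact tendsto_zero_iff_norm_tendsto_zero.2 h4
  simpa using h1.add hy

open Classical in
/-- The image of the indicator function of `S` under the extension of `π` to Borel functions,
applied to the vector `x`. -/
def repIndicatorFun (S : Set X) (x : H) : H :=
  if hS : MeasurableSet S then (exists_tendsto_representation π x hS).choose else 0

theorem tendsto_repIndicatorFun {x : H} {S : Set X} (hS : MeasurableSet S) {f : ℕ → C(X, ℝ)}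
    (hf : ApproxIndicator (repMeasure π x) S f) :
    Tendsto (fun n => π (f n) x) atTop (𝓝 (repIndicatorFun π S x)) := by
  rw [repIndicatorFun, dif_pos hS]
  exact (exists_tendsto_representation π x hS).choose_spec f hf

/-- Approximation in `L¹` of the sum of the measures holds for each summand. -/
theorem exists_common_approxIndicator (x y z : H) {S : Set X} (hS : MeasurableSet S) :
    ∃ f, ApproxIndicator (repMeasure π x) S f ∧ ApproxIndicator (repMeasure π y) S f ∧
      ApproxIndicator (repMeasure π z) S f := by
  obtain ⟨f, hf⟩ := exists_approxIndicator (repMeasure π x + repMeasure π y + repMeasure π z) hS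
  refine ⟨f, hf.mono hS ?_, hf.mono hS ?_, hf.mono hS (Measure.le_add_left le_rfl)⟩
  · exact (Measure.le_add_right le_rfl).trans (Measure.le_add_right le_rfl)
  · exact (Measure.le_add_left le_rfl).trans (Measure.le_add_right le_rfl)

theorem norm_representation_le (f : C(X, ℝ)) (h0 : ∀ k, 0 ≤ f k) (h1 : ∀ k, f k ≤ 1) (x : H) :
    ‖π f x‖ ≤ ‖x‖ := by
  refine (pow_le_pow_iff_left₀ (norm_nonneg _) (norm_nonneg _) two_ne_zero).1 ?_
  rw [← integral_sq_repMeasure, ← repMeasure_real_univ π x]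
  have : (repMeasure π x).real univ = ∫ _, (1 : ℝ) ∂(repMeasure π x) := by simp
  rw [this]
  refine integral_mono (integrable_continuousMap _ (f ^ 2)) (integrable_const 1) fun k => ?_
  exact pow_le_one₀ (h0 k) (h1 k)

/-- The image of the indicator function of `S` under the extension of `π` to Borel functions. -/
def repIndicator (S : Set X) (hS : MeasurableSet S) : H →L[ℂ] H :=
  LinearMap.mkContinuous
    { toFun := repIndicatorFun π S
      map_add' := fun x y => by
        obtain ⟨f, h1, h2, h3⟩ := exists_common_approxIndicator π x y (x + y) hS
        refine tendsto_nhds_unique (tendsto_repIndicatorFun π hS h3) ?_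
        simp_rw [map_add]
        exact (tendsto_repIndicatorFun π hS h1).add (tendsto_repIndicatorFun π hS h2)
      map_smul' := fun c x => by
        obtain ⟨f, h1, -, h3⟩ := exists_common_approxIndicator π x x (c • x) hS
        refine tendsto_nhds_unique (tendsto_repIndicatorFun π hS h3) ?_
        simp_rw [map_smul]
        exact (tendsto_repIndicatorFun π hS h1).const_smul c } 1 (fun x => by
    obtain ⟨f, hf⟩ := exists_approxIndicator (repMeasure π x) hS
    rw [one_mul]
    exact le_of_tendsto (tendsto_repIndicatorFun π hS hf).norm (Eventually.of_forall fun n =>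
      norm_representation_le π (f n) (hf.nonneg n) (hf.le_one n) x))

theorem tendsto_repIndicator {x : H} {S : Set X} (hS : MeasurableSet S) {f : ℕ → C(X, ℝ)}
    (hf : ApproxIndicator (repMeasure π x) S f) :
    Tendsto (fun n => π (f n) x) atTop (𝓝 (repIndicator π S hS x)) :=
  tendsto_repIndicatorFun π hS hf

/-- Products of approximants of `S` and `T` approximate `S ∩ T`. Idempotence, symmetry and
multiplicativity of the projections all follow from this identity. -/
theorem inner_repIndicator_repIndicator {S T : Set X} (hS : MeasurableSet S)
    (hT : MeasurableSet T) (x y : H) :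
    ⟪repIndicator π S hS x, repIndicator π T hT y⟫_ℂ =
      ⟪x, repIndicator π (S ∩ T) (hS.inter hT) y⟫_ℂ := by
  obtain ⟨f, hfx, hfy, -⟩ := exists_common_approxIndicator π x y y hS
  obtain ⟨g, hgx, hgy, -⟩ := exists_common_approxIndicator π x y y hT
  have h1 := (tendsto_repIndicator π hS hfx).inner (𝕜 := ℂ) (tendsto_repIndicator π hT hgy)
  have h2 := (tendsto_const_nhds (x := x)).inner (𝕜 := ℂ)
    (tendsto_repIndicator π (hS.inter hT) (hfy.mul hgy hS hT))
  have h3 : ∀ n, ⟪x, π (f n * g n) y⟫_ℂ = ⟪π (f n) x, π (g n) y⟫_ℂ := fun n => by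
    rw [representation_mul_apply, inner_representation_left]
  simp_rw [h3] at h2
  exact tendsto_nhds_unique h1 h2

theorem repIndicator_univ : repIndicator π univ MeasurableSet.univ = 1 := by
  ext x
  have h : ApproxIndicator (repMeasure π x) univ fun _ => 1 :=
    ⟨fun _ _ => zero_le_one, fun _ _ => le_rfl, by simp⟩
  refine tendsto_nhds_unique (tendsto_repIndicator π MeasurableSet.univ h) ?_
  rw [map_one]
  exact tendsto_const_nhds

theorem inner_repIndicator_left {S : Set X} (hS : MeasurableSet S) (x y : H) :
    ⟪repIndicator π S hS x, y⟫_ℂ = ⟪x, repIndicator π S hS y⟫_ℂ := by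
  have h := inner_repIndicator_repIndicator π hS MeasurableSet.univ x y
  simp_rw [repIndicator_univ, inter_univ] at h
  exact h

theorem repIndicator_mul {S T : Set X} (hS : MeasurableSet S) (hT : MeasurableSet T) :
    repIndicator π S hS * repIndicator π T hT = repIndicator π (S ∩ T) (hS.inter hT) := by
  ext y
  refine ext_inner_left ℂ fun x => ?_
  rw [← inner_repIndicator_repIndicator π hS hT, inner_repIndicator_left π hS]
  rfl

theorem isStarProjection_repIndicator {S : Set X} (hS : MeasurableSet S) :
    IsStarProjection (repIndicator π S hS) := by
  refine ⟨?_, ?_⟩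
  · rw [IsIdempotentElem, repIndicator_mul]
    simp_rw [inter_self]
  · rw [ContinuousLinearMap.isSelfAdjoint_iff_isSymmetric]
    exact fun x y => inner_repIndicator_left π hS x y

theorem re_inner_repIndicator {S : Set X} (hS : MeasurableSet S) (x : H) :
    (⟪x, repIndicator π S hS x⟫_ℂ).re = ‖repIndicator π S hS x‖ ^ 2 := by
  have h1 := inner_repIndicator_repIndicator π hS hS x x
  simp_rw [inter_self] at h1
  rw [← h1]
  exact inner_self_eq_norm_sq (𝕜 := ℂ) _

theorem norm_sq_repIndicator {S : Set X} (hS : MeasurableSet S) (x : H) :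
    ‖repIndicator π S hS x‖ ^ 2 = (repMeasure π x).real S := by
  obtain ⟨f, hf⟩ := exists_approxIndicator (repMeasure π x) hS
  have h3 := (Complex.continuous_re.tendsto _).comp
    ((tendsto_const_nhds (x := x)).inner (𝕜 := ℂ) (tendsto_repIndicator π hS hf))
  have h4 := hf.tendsto_integral hS
  simp_rw [integral_repMeasure] at h4
  rw [← re_inner_repIndicator]
  exact tendsto_nhds_unique h3 h4

/-- With `Z` the projection of the union, `P x ⟂ Q x`, `Z` fixes both, and `‖Z x‖² = ‖P x‖² + ‖Q
x‖²` by additivity of the measure; expanding `‖Z x - (P x + Q x)‖²` gives zero. -/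
theorem repIndicator_union {S T : Set X} (hS : MeasurableSet S) (hT : MeasurableSet T)
    (hd : Disjoint S T) :
    repIndicator π (S ∪ T) (hS.union hT) = repIndicator π S hS + repIndicator π T hT := by
  ext x
  set P := repIndicator π S hS with hP
  set Q := repIndicator π T hT with hQ
  set Z := repIndicator π (S ∪ T) (hS.union hT) with hZ
  have h1 : Z * P = P := by
    rw [hZ, hP, repIndicator_mul]
    simp_rw [union_inter_cancel_left]
  have h2 : Z * Q = Q := by
    rw [hZ, hQ, repIndicator_mul]
    simp_rw [union_inter_cancel_right]
  have h3 : ∀ u v, ⟪Z u, v⟫_ℂ = ⟪u, Z v⟫_ℂ := inner_repIndicator_left π (hS.union hT)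
  have h4 : ⟪P x, Q x⟫_ℂ = 0 := by
    rw [hP, hQ, inner_repIndicator_repIndicator]
    have : repIndicator π (S ∩ T) (hS.inter hT) x = 0 := by
      rw [← norm_eq_zero, ← sq_eq_zero_iff, norm_sq_repIndicator, hd.inter_eq]
      simp
    rw [this, inner_zero_right]
  have h5 : ‖P x + Q x‖ ^ 2 = ‖P x‖ ^ 2 + ‖Q x‖ ^ 2 := by
    rw [norm_add_sq (𝕜 := ℂ), h4]
    simp
  have h6 : ‖Z x‖ ^ 2 = ‖P x‖ ^ 2 + ‖Q x‖ ^ 2 := by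
    rw [hZ, hP, hQ, norm_sq_repIndicator, norm_sq_repIndicator, norm_sq_repIndicator,
      measureReal_union hd hT]
  have h7 : (⟪Z x, P x + Q x⟫_ℂ).re = ‖P x‖ ^ 2 + ‖Q x‖ ^ 2 := by
    have h8 : Z (P x + Q x) = P x + Q x := by
      rw [map_add]
      exact congrArg₂ (· + ·) (congrArg (fun B : H →L[ℂ] H => B x) h1)
        (congrArg (fun B : H →L[ℂ] H => B x) h2)
    rw [h3, h8, inner_add_right, Complex.add_re, re_inner_repIndicator,
      re_inner_repIndicator]
  have h10 : ‖Z x - (P x + Q x)‖ ^ 2 = 0 := by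
    have := norm_sub_sq (𝕜 := ℂ) (Z x) (P x + Q x)
    rw [this, h5, h6]
    change _ - 2 * (⟪Z x, P x + Q x⟫_ℂ).re + _ = 0
    rw [h7]
    ring
  simpa [sub_eq_zero] using h10

theorem repIndicator_biUnion {S : ℕ → Set X} (hS : ∀ n, MeasurableSet (S n))
    (hd : Pairwise (Function.onFun Disjoint S)) (F : Finset ℕ) (x : H) :
    repIndicator π (⋃ n ∈ F, S n) (F.measurableSet_biUnion fun n _ => hS n) x =
      ∑ n ∈ F, repIndicator π (S n) (hS n) x := by
  classical
  induction F using Finset.induction_on with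
  | empty =>
    rw [Finset.sum_empty, ← norm_eq_zero, ← sq_eq_zero_iff, norm_sq_repIndicator]
    simp
  | insert a F ha ih =>
    rw [Finset.sum_insert ha, ← ih]
    have h1 : Disjoint (S a) (⋃ n ∈ F, S n) := by
      rw [Set.disjoint_iUnion₂_right]
      intro n hn
      exact hd fun h => ha (h ▸ hn)
    have h2 := repIndicator_union π (hS a) (F.measurableSet_biUnion fun n _ => hS n) h1
    have h3 := congrArg (fun B : H →L[ℂ] H => B x) h2
    simp_rw [Finset.set_biUnion_insert]
    exact h3

/-- The squared distance of a partial sum from the limit is the measure of the sets left out, so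
strong countable additivity reduces to that of the scalar measure. -/
theorem hasSum_repIndicator {S : ℕ → Set X} (hS : ∀ n, MeasurableSet (S n))
    (hd : Pairwise (Function.onFun Disjoint S)) (x : H) :
    HasSum (fun n => repIndicator π (S n) (hS n) x)
      (repIndicator π (⋃ n, S n) (MeasurableSet.iUnion hS) x) := by
  set ν := repMeasure π x with hν
  have h1 : HasSum (fun n => ν.real (S n)) (ν.real (⋃ n, S n)) := by
    have h2 := measure_iUnion (μ := ν) hd hS
    have h3 := ENNReal.hasSum_toReal (f := fun n => ν (S n)) (by
      rw [← h2]
      exact measure_ne_top _ _)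
    rwa [← ENNReal.tsum_toReal_eq (fun n => measure_ne_top _ _), ← h2] at h3
  have h4 : ∀ F : Finset ℕ, ‖(∑ n ∈ F, repIndicator π (S n) (hS n) x)
      - repIndicator π (⋃ n, S n) (MeasurableSet.iUnion hS) x‖ ^ 2
        = ν.real (⋃ n, S n) - ∑ n ∈ F, ν.real (S n) := by
    intro F
    set SF := ⋃ n ∈ F, S n with hSF
    have hF : MeasurableSet SF := F.measurableSet_biUnion fun n _ => hS n
    have hsub : SF ⊆ ⋃ n, S n := iUnion₂_subset_iUnion _ _
    have hm := (MeasurableSet.iUnion hS).diff hF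
    have h5 := congrArg (fun B : H →L[ℂ] H => B x)
      (repIndicator_union π hF hm disjoint_sdiff_right)
    simp_rw [union_sdiff_cancel hsub] at h5
    rw [h5, ← repIndicator_biUnion π hS hd F x]
    change ‖_ - (repIndicator π SF hF x + repIndicator π _ hm x)‖ ^ 2 = _
    rw [sub_add_cancel_left, norm_neg, norm_sq_repIndicator, measureReal_sdiff hsub hF,
      measureReal_biUnion_finset (fun i _ j _ hij => hd hij) fun n _ => hS n]
  rw [HasSum, SummationFilter.unconditional_filter, tendsto_iff_norm_sub_tendsto_zero]
  have h6 : Tendsto (fun F : Finset ℕ => ν.real (⋃ n, S n) - ∑ n ∈ F, ν.real (S n)) atTop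
      (𝓝 0) := by
    have h7 : Tendsto (fun F : Finset ℕ => ∑ n ∈ F, ν.real (S n)) atTop
      (𝓝 (ν.real (⋃ n, S n))) := by simpa [HasSum] using h1
    simpa using h7.const_sub (ν.real (⋃ n, S n))
  simp_rw [← h4] at h6
  have h8 := h6.sqrt
  simp_rw [Real.sqrt_sq (norm_nonneg _), Real.sqrt_zero] at h8
  exact h8

open Classical in
/-- The projection-valued measure on `ℝ` obtained from a representation of `C(X, ℝ)` and a
measurable function on `X`. -/
def repPVM {φ : X → ℝ} (hφ : Measurable φ) : ProjectionValuedMeasure H where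
  proj S := if hS : MeasurableSet S then repIndicator π (φ ⁻¹' S) (hφ hS) else 0
  isStarProjection S hS := by
    rw [dif_pos hS]
    exact isStarProjection_repIndicator π (hφ hS)
  empty := by
    rw [dif_pos MeasurableSet.empty]
    ext x
    rw [zero_apply, ← norm_eq_zero, ← sq_eq_zero_iff, norm_sq_repIndicator]
    simp
  univ := by
    rw [dif_pos MeasurableSet.univ]
    exact repIndicator_univ π
  inter S T hS hT := by
    rw [dif_pos hS, dif_pos hT, dif_pos (hS.inter hT), repIndicator_mul]
    rfl
  iUnion S hS hd x := by
    rw [dif_pos (MeasurableSet.iUnion hS)]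
    simp_rw [dif_pos (hS _), preimage_iUnion]
    exact hasSum_repIndicator π (fun n => hφ (hS n)) (fun i j hij => (hd hij).preimage φ) x

theorem scalarMeasure_repPVM {φ : X → ℝ} (hφ : Measurable φ) (x : H) :
    (repPVM π hφ).scalarMeasure x = (repMeasure π x).map φ := by
  ext S hS
  rw [Measure.map_apply hφ hS, ProjectionValuedMeasure.scalarMeasure,
    Measure.ofMeasurable_apply S hS]
  have h1 : (repPVM π hφ).proj S = repIndicator π (φ ⁻¹' S) (hφ hS) := dif_pos hS
  rw [h1, re_inner_repIndicator, norm_sq_repIndicator, ofReal_measureReal]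

end Representation

/-! ### The spectral theorem for a non-negative self-adjoint operator -/

section SpectralTheorem

section Representation

variable {X : Type*} [MetricSpace X] [CompactSpace X] [MeasurableSpace X] [BorelSpace X]
variable (π : C(X, ℝ) →⋆ₐ[ℝ] (H →L[ℂ] H))

theorem measurable_ofReal_sq {f : X → ℝ} (hf : Measurable f) :
    Measurable fun k => ENNReal.ofReal (f k ^ 2) :=
  ENNReal.measurable_ofReal.comp (hf.pow_const 2)

/-- Because `⟪π ι u, π f (π ι u)⟫ = ⟪u, π(ι² f) u⟫`. -/
theorem repMeasure_representation (ι : C(X, ℝ)) (u : H) :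
    repMeasure π (π ι u) =
      (repMeasure π u).withDensity fun k => ENNReal.ofReal (ι k ^ 2) := by
  have hfin : IsFiniteMeasure ((repMeasure π u).withDensity fun k => ENNReal.ofReal (ι k ^ 2)) :=
    isFiniteMeasure_withDensity_ofReal (integrable_continuousMap _ (ι ^ 2)).2
  refine measure_eq_of_forall_integral_eq fun f => ?_
  rw [integral_withDensity_eq_integral_toReal_smul
    (measurable_ofReal_sq ι.continuous.measurable)
    (Eventually.of_forall fun k => ENNReal.ofReal_lt_top), integral_repMeasure,
    inner_representation_left, ← representation_mul_apply, ← representation_mul_apply,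
    ← integral_repMeasure]
  refine integral_congr_ae (Eventually.of_forall fun k => ?_)
  simp only [ContinuousMap.mul_apply, smul_eq_mul, ENNReal.toReal_ofReal (sq_nonneg (ι k))]
  ring

/-- For vectors `π ι u` the density `ι²` vanishes on this set, so its projection kills a dense
subspace. It ensures that `ι⁻¹` is meaningful almost everywhere. -/
theorem repMeasure_zero_set {ι : C(X, ℝ)} (hd : DenseRange (π ι)) (x : H) :
    repMeasure π x {k | ι k = 0} = 0 := by
  have hS : MeasurableSet {k | ι k = 0} := (isClosed_eq ι.continuous continuous_const).measurableSet
  have h1 : ∀ u, repIndicator π _ hS (π ι u) = 0 := by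
    intro u
    rw [← norm_eq_zero, ← sq_eq_zero_iff, norm_sq_repIndicator, repMeasure_representation,
      Measure.real, withDensity_apply _ hS]
    rw [setLIntegral_congr_fun (g := fun _ => 0) hS fun k hk => by
      have : ι k = 0 := hk
      simp [this]]
    simp
  have h2 : repIndicator π _ hS x = 0 := by
    refine hd.induction_on (p := fun x => repIndicator π _ hS x = 0) x ?_ h1
    exact isClosed_eq (repIndicator π _ hS).continuous continuous_const
  have h3 := norm_sq_repIndicator π hS x
  rw [h2, norm_zero, zero_pow two_ne_zero] at h3
  exact (measureReal_eq_zero_iff).1 h3.symm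

/-- If `ι⁻¹` is square integrable with respect to the measure of `x`, then `x` is in the range
of `π(ι)`. -/
theorem exists_representation_eq {ι : C(X, ℝ)} (h0 : ∀ k, 0 ≤ ι k) {x : H}
    (hz : repMeasure π x {k | ι k = 0} = 0)
    (hint : Integrable (fun k => ((ι k)⁻¹) ^ 2) (repMeasure π x)) : ∃ u, π ι u = x := by
  set ν := repMeasure π x with hν
  have hpos : ∀ᵐ k ∂ν, 0 < ι k := by
    have : ∀ᵐ k ∂ν, ι k ≠ 0 := by
      rw [ae_iff]
      simpa using hz
    filter_upwards [this] with k hk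
    exact lt_of_le_of_ne (h0 k) (Ne.symm hk)
  -- Continuous truncations of `ι⁻¹`. They converge to it in `L²(ν)`, so `π (g n) x` has a limit
  -- `u`; since `ι * g n → 1` in `L²(ν)`, it satisfies `π ι u = x`.
  let g : ℕ → C(X, ℝ) := fun n => ⟨fun k => cutoffInv n (ι k) + 1,
    ((continuous_cutoffInv n).comp ι.continuous).add continuous_const⟩
  have hg : ∀ n k, g n k = (max (ι k) (1 / ((n : ℝ) + 1)))⁻¹ := fun n k => by
    change cutoffInv n (ι k) + 1 = _
    rw [cutoffInv, sub_add_cancel]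
  have hg0 : ∀ n k, 0 ≤ g n k := fun n k => by
    rw [hg]
    exact inv_nonneg.2 ((h0 k).trans (le_max_left _ _))
  have hgle : ∀ n k, 0 < ι k → g n k ≤ (ι k)⁻¹ := fun n k hk => by
    rw [hg]
    exact inv_anti₀ hk (le_max_left _ _)
  have hev : ∀ k, 0 < ι k → ∀ᶠ n in atTop, g n k = (ι k)⁻¹ := by
    intro k hk
    have h1 := tendsto_one_div_add_atTop_nhds_zero_nat (𝕜 := ℝ)
    filter_upwards [h1.eventually (gt_mem_nhds hk)] with n hn
    rw [hg, max_eq_left hn.le]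
  have hmeas : ∀ n, AEStronglyMeasurable (fun k => (g n k - (ι k)⁻¹) ^ 2) ν := fun n =>
    Measurable.aestronglyMeasurable (((g n).continuous.measurable.sub
      ι.continuous.measurable.inv).pow_const 2)
  have hbd : ∀ n, ∀ᵐ k ∂ν, ‖(g n k - (ι k)⁻¹) ^ 2‖ ≤ ((ι k)⁻¹) ^ 2 := by
    intro n
    filter_upwards [hpos] with k hk
    rw [Real.norm_of_nonneg (sq_nonneg _)]
    have h1 := hg0 n k
    have h2 := hgle n k hk
    nlinarith
  have hI : ∀ n, Integrable (fun k => (g n k - (ι k)⁻¹) ^ 2) ν := fun n =>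
    hint.mono' (hmeas n) (hbd n)
  have hlim : Tendsto (fun n => ∫ k, (g n k - (ι k)⁻¹) ^ 2 ∂ν) atTop (𝓝 0) := by
    have h1 := tendsto_integral_of_dominated_convergence (f := fun _ => (0 : ℝ))
      (fun k => ((ι k)⁻¹) ^ 2) hmeas hint hbd (by
        filter_upwards [hpos] with k hk
        refine tendsto_const_nhds.congr' ?_
        filter_upwards [hev k hk] with n hn
        rw [hn, sub_self, zero_pow two_ne_zero])
    simpa using h1
  have hnorm : ∀ n m, ‖π (g n) x - π (g m) x‖ ^ 2 ≤
      2 * ∫ k, (g n k - (ι k)⁻¹) ^ 2 ∂ν + 2 * ∫ k, (g m k - (ι k)⁻¹) ^ 2 ∂ν := by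
    intro n m
    have h1 : π (g n) x - π (g m) x = π (g n - g m) x := by
      rw [map_sub]
      rfl
    rw [h1, ← integral_sq_repMeasure, ← integral_const_mul, ← integral_const_mul,
      ← integral_add ((hI n).const_mul 2) ((hI m).const_mul 2)]
    refine integral_mono (integrable_continuousMap _ ((g n - g m) ^ 2))
      (((hI n).const_mul 2).add ((hI m).const_mul 2)) fun k => ?_
    dsimp only
    rw [ContinuousMap.sub_apply]
    nlinarith [sq_nonneg ((g n k - (ι k)⁻¹) + (g m k - (ι k)⁻¹))]
  have hc : CauchySeq fun n => π (g n) x := by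
    rw [Metric.cauchySeq_iff]
    intro ε hε
    obtain ⟨N, hN⟩ := Metric.tendsto_atTop.1 hlim (ε ^ 2 / 4) (by positivity)
    refine ⟨N, fun m hm n hn => ?_⟩
    have h2 := hN m hm
    have h3 := hN n hn
    rw [Real.dist_0_eq_abs] at h2 h3
    have h4 := (le_abs_self _).trans_lt h2
    have h5 := (le_abs_self _).trans_lt h3
    rw [dist_eq_norm]
    exact lt_of_pow_lt_pow_left₀ 2 hε.le (by linarith [hnorm m n])
  obtain ⟨u, hu⟩ := cauchySeq_tendsto_of_complete hc
  refine ⟨u, ?_⟩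
  refine tendsto_nhds_unique (((π ι).continuous.tendsto u).comp hu) ?_
  have hone : Tendsto (fun n => ∫ k, (ι * g n - 1) k ^ 2 ∂ν) atTop (𝓝 0) := by
    have h1 := tendsto_integral_of_dominated_convergence (μ := ν)
      (F := fun n k => (ι * g n - 1) k ^ 2) (f := fun _ => (0 : ℝ)) (fun _ => 1)
      (fun n => (integrable_continuousMap ν ((ι * g n - 1) ^ 2)).aestronglyMeasurable)
      (integrable_const _) (fun n => Eventually.of_forall fun k => by
        have h2 := mul_inv_max_mem (n := n) (h0 k)
        rw [Real.norm_of_nonneg (sq_nonneg _), ContinuousMap.sub_apply, ContinuousMap.mul_apply,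
          ContinuousMap.one_apply, hg, mul_comm]
        nlinarith) (by
        filter_upwards [hpos] with k hk
        refine tendsto_const_nhds.congr' ?_
        filter_upwards [hev k hk] with n hn
        rw [ContinuousMap.sub_apply, ContinuousMap.mul_apply, hn, mul_inv_cancel₀ hk.ne',
          ContinuousMap.one_apply, sub_self, zero_pow two_ne_zero])
    simpa using h1
  rw [tendsto_iff_norm_sub_tendsto_zero]
  have h8 := hone.sqrt
  simp_rw [hν, integral_sq_repMeasure, Real.sqrt_sq (norm_nonneg _), Real.sqrt_zero, map_sub,
    map_one] at h8
  refine h8.congr fun n => ?_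
  rw [map_mul]
  rfl

end Representation

variable {A : H →ₗ.[ℂ] H}

/-- The **spectral theorem** for a non-negative self-adjoint operator. -/
theorem exists_isSpectralMeasureOf (hA : IsSelfAdjoint A) (hp : IsNonneg A) :
    ∃ E : ProjectionValuedMeasure H, E.IsSpectralMeasureOf A := by
  obtain ⟨R, hR⟩ := exists_isResolvent hA hp one_pos
  have hRs := hR.isSelfAdjoint hA
  have hspec := hR.spectrum_subset hA hp
  set π : C(spectrum ℝ R, ℝ) →⋆ₐ[ℝ] (H →L[ℂ] H) := cfcHom hRs with hπ
  set ι : C(spectrum ℝ R, ℝ) := (ContinuousMap.id ℝ).restrict (spectrum ℝ R) with hι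
  have hπι : π ι = R := cfcHom_id hRs
  have hι0 : ∀ k, 0 ≤ ι k := fun k => (hspec k.2).1
  have hι1 : ∀ k, ι k ≤ 1 := fun k => (hspec k.2).2
  -- The change of variable `λ = r⁻¹ - 1`. Where `ι k = 0` its value is the default `-1`; this is
  -- harmless, since `ι² φ = ι - ι²` still holds there and the set is null.
  let φ : spectrum ℝ R → ℝ := fun k => (ι k)⁻¹ - 1
  have hφ : Measurable φ := ι.continuous.measurable.inv.sub_const 1
  have hφι : ∀ k, ι k ^ 2 * φ k = ι k - ι k ^ 2 := by
    intro k
    change ι k ^ 2 * ((ι k)⁻¹ - 1) = _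
    rcases eq_or_ne (ι k) 0 with h | h
    · simp [h]
    · field_simp
  have hdense : DenseRange (π ι) := by
    rw [hπι]
    exact hR.denseRange hA
  refine ⟨repPVM π hφ, fun x => ?_, fun x => ?_⟩
  · have hmap : ∫⁻ r, ENNReal.ofReal (r ^ 2) ∂((repPVM π hφ).scalarMeasure x) =
        ∫⁻ k, ENNReal.ofReal (φ k ^ 2) ∂(repMeasure π x) := by
      rw [scalarMeasure_repPVM, lintegral_map (by fun_prop) hφ]
    rw [hmap]
    constructor
    · intro hx
      obtain ⟨u, rfl⟩ : ∃ u, π ι u = x := ⟨_, by rw [hπι]; exact hR.left_inv ⟨x, hx⟩⟩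
      rw [repMeasure_representation, lintegral_withDensity_eq_lintegral_mul _
        (measurable_ofReal_sq ι.continuous.measurable)
        (measurable_ofReal_sq hφ)]
      refine lt_of_le_of_lt (lintegral_mono (g := fun _ => 1) fun k => ?_) ?_
      · rw [Pi.mul_apply, ← ENNReal.ofReal_mul (sq_nonneg _), ENNReal.ofReal_le_one]
        have h1 : ι k ^ 2 * φ k ^ 2 ≤ 1 := by
          change ι k ^ 2 * ((ι k)⁻¹ - 1) ^ 2 ≤ 1
          rcases eq_or_ne (ι k) 0 with h | h
          · simp [h]
          · rw [← mul_pow, mul_sub, mul_inv_cancel₀ h, mul_one]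
            nlinarith [hι0 k, hι1 k]
        exact h1
      · simp
    · intro hx
      have h1 : Integrable (fun k => φ k ^ 2) (repMeasure π x) := by
        refine ⟨(hφ.pow_const 2).aestronglyMeasurable, ?_⟩
        rw [hasFiniteIntegral_iff_norm]
        simpa using hx
      -- Square integrability of `λ = r⁻¹ - 1` for a finite measure gives that of `r⁻¹`, hence `x`
      -- lies in `Ran R`, the domain of `A`.
      have h2 : Integrable (fun k => ((ι k)⁻¹) ^ 2) (repMeasure π x) := by
        refine ((h1.const_mul 2).add (integrable_const 2)).mono'
          (ι.continuous.measurable.inv.pow_const 2).aestronglyMeasurable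
          (Eventually.of_forall fun k => ?_)
        rw [Real.norm_of_nonneg (sq_nonneg _)]
        change ((ι k)⁻¹) ^ 2 ≤ 2 * ((ι k)⁻¹ - 1) ^ 2 + 2
        nlinarith [sq_nonneg ((ι k)⁻¹ - 2)]
      obtain ⟨u, rfl⟩ := exists_representation_eq π hι0 (repMeasure_zero_set π hdense x) h2
      rw [hπι]
      exact hR.mem u
  · rw [inner_self_apply_eq_re hA, scalarMeasure_repPVM,
      integral_map hφ.aemeasurable (by fun_prop)]
    congr 1
    obtain ⟨x, hx⟩ := x
    obtain ⟨u, rfl⟩ : ∃ u, R u = x := ⟨_, hR.left_inv ⟨x, hx⟩⟩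
    have h1 : (⟪R u, A ⟨R u, hx⟩⟫_ℂ).re = ∫ k, (ι - ι ^ 2) k ∂(repMeasure π u) := by
      rw [hR.apply, integral_repMeasure, map_sub, map_pow, hπι, hR.inner_left hA]
      congr 2
      rw [map_sub, Complex.ofReal_one, one_smul]
      simp [sq]
    rw [h1]
    have h2 : repMeasure π (R u) = repMeasure π (π ι u) := by rw [hπι]
    dsimp only
    rw [h2, repMeasure_representation, integral_withDensity_eq_integral_toReal_smul
      (measurable_ofReal_sq ι.continuous.measurable)
      (Eventually.of_forall fun k => ENNReal.ofReal_lt_top)]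
    refine integral_congr_ae (Eventually.of_forall fun k => ?_)
    dsimp only
    rw [ENNReal.toReal_ofReal (sq_nonneg _), smul_eq_mul, hφι]
    rfl

end SpectralTheorem

/-! ### Spectral tails bounded by the quadratic form -/

section SpectralTail

variable {A : H →ₗ.[ℂ] H}

namespace ProjectionValuedMeasure

variable (E : ProjectionValuedMeasure H)

theorem inner_proj_eq {S : Set ℝ} (hS : MeasurableSet S) (x : H) :
    (⟪x, E.proj S x⟫_ℂ).re = ‖E.proj S x‖ ^ 2 := by
  have hP := E.isStarProjection S hS
  have h1 : E.proj S x = E.proj S (E.proj S x) := by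
    conv_lhs => rw [← hP.isIdempotentElem.eq]
    rfl
  rw [h1, ← ContinuousLinearMap.adjoint_inner_left, ← ContinuousLinearMap.star_eq_adjoint,
    hP.isSelfAdjoint.star_eq, ← h1]
  exact inner_self_eq_norm_sq (𝕜 := ℂ) _

theorem scalarMeasure_apply {S : Set ℝ} (hS : MeasurableSet S) (x : H) :
    E.scalarMeasure x S = ENNReal.ofReal (⟪x, E.proj S x⟫_ℂ).re :=
  Measure.ofMeasurable_apply S hS

theorem scalarMeasure_apply_eq_norm_sq {S : Set ℝ} (hS : MeasurableSet S) (x : H) :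
    E.scalarMeasure x S = ENNReal.ofReal (‖E.proj S x‖ ^ 2) := by
  rw [E.scalarMeasure_apply hS, E.inner_proj_eq hS]

instance (x : H) : IsFiniteMeasure (E.scalarMeasure x) :=
  ⟨by rw [E.scalarMeasure_apply MeasurableSet.univ]; exact ENNReal.ofReal_lt_top⟩

theorem norm_proj_apply_le {S : Set ℝ} (hS : MeasurableSet S) (x : H) : ‖E.proj S x‖ ≤ ‖x‖ := by
  have h1 := E.inner_proj_eq hS x
  have h2 : (⟪x, E.proj S x⟫_ℂ).re ≤ ‖x‖ * ‖E.proj S x‖ := re_inner_le_norm (𝕜 := ℂ) _ _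
  by_contra! hlt
  nlinarith [norm_nonneg x, norm_nonneg (E.proj S x)]

/-- Makes it possible to test statements about `A` on spectral subspaces. -/
theorem scalarMeasure_proj {S : Set ℝ} (hS : MeasurableSet S) (x : H) :
    E.scalarMeasure (E.proj S x) = (E.scalarMeasure x).restrict S := by
  ext T hT
  rw [Measure.restrict_apply hT, E.scalarMeasure_apply_eq_norm_sq hT,
    E.scalarMeasure_apply_eq_norm_sq (hT.inter hS), E.inter T S hT hS]
  rfl

namespace IsSpectralMeasureOf

variable {E}

theorem integrable_id (hE : E.IsSpectralMeasureOf A) {x : H} (hx : x ∈ A.domain) :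
    Integrable (fun r => r) (E.scalarMeasure x) := by
  have h1 := (hE.mem_domain x).1 hx
  have h2 : Integrable (fun r : ℝ => r ^ 2) (E.scalarMeasure x) := by
    refine ⟨by fun_prop, ?_⟩
    rw [hasFiniteIntegral_iff_norm]
    simpa using h1
  refine (h2.add (integrable_const 1)).mono' (by fun_prop) (Eventually.of_forall fun r => ?_)
  simp only [Pi.add_apply, Real.norm_eq_abs]
  nlinarith [sq_abs r, abs_nonneg r, sq_nonneg (|r| - 1)]

/-- Positivity of `A` on the projection of `x` to the negative half-line says that `∫ r` over that
half-line is nonnegative; the integrand is negative there, so the half-line is null. -/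
theorem ae_nonneg (hE : E.IsSpectralMeasureOf A) (hp : IsNonneg A) {x : H} (hx : x ∈ A.domain) :
    ∀ᵐ r ∂(E.scalarMeasure x), 0 ≤ r := by
  have hS : MeasurableSet (Iio (0 : ℝ)) := measurableSet_Iio
  have hz : E.proj (Iio 0) x ∈ A.domain := by
    rw [hE.mem_domain, E.scalarMeasure_proj hS]
    exact (setLIntegral_le_lintegral _ _).trans_lt ((hE.mem_domain x).1 hx)
  have h1 := hp ⟨_, hz⟩
  rw [hE.inner_apply, E.scalarMeasure_proj hS, Complex.ofReal_re] at h1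
  have h2 := (hE.integrable_id hx).restrict (s := Iio (0 : ℝ))
  have h3 : 0 ≤ᵐ[(E.scalarMeasure x).restrict (Iio 0)] fun r => -r := by
    filter_upwards [ae_restrict_mem hS] with r hr
    exact neg_nonneg.2 (le_of_lt hr)
  have h4 : ∫ r in Iio 0, -r ∂(E.scalarMeasure x) = 0 := by
    refine le_antisymm ?_ (integral_nonneg_of_ae h3)
    rw [integral_neg]
    linarith
  rw [integral_eq_zero_iff_of_nonneg_ae h3 h2.neg] at h4
  rw [Filter.EventuallyEq, ae_restrict_iff' hS] at h4
  filter_upwards [h4] with r hr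
  by_contra! hlt
  have := hr hlt
  simp only [Pi.zero_apply, neg_eq_zero] at this
  linarith

/-- Chebyshev's inequality for the spectral measure, applicable because the measure lives on `[0,
∞)`. -/
theorem mul_norm_sq_le (hE : E.IsSpectralMeasureOf A) (hp : IsNonneg A) (x : A.domain) {c : ℝ}
    (hc : 0 < c) : c * ‖E.proj (Ioi c) x‖ ^ 2 ≤ (⟪(x : H), A x⟫_ℂ).re := by
  rw [hE.inner_apply, Complex.ofReal_re]
  have h1 := mul_meas_ge_le_integral_of_nonneg (hE.ae_nonneg hp x.2) (hE.integrable_id x.2) c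
  refine le_trans ?_ h1
  gcongr
  have h2 : (E.scalarMeasure (x : H)).real (Ioi c) = ‖E.proj (Ioi c) x‖ ^ 2 := by
    rw [Measure.real, E.scalarMeasure_apply_eq_norm_sq measurableSet_Ioi,
      ENNReal.toReal_ofReal (sq_nonneg _)]
  rw [← h2]
  exact measureReal_mono fun r hr => by
    rw [mem_ofPred_eq]
    exact le_of_lt hr

end IsSpectralMeasureOf

end ProjectionValuedMeasure

theorem exists_spectralProjection_eq (hA : IsSelfAdjoint A) (hp : IsNonneg A) :
    ∃ E : ProjectionValuedMeasure H, E.IsSpectralMeasureOf A ∧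
      ∀ S, spectralProjection A S = E.proj S := by
  have h := exists_isSpectralMeasureOf hA hp
  refine ⟨h.choose, h.choose_spec, fun S => ?_⟩
  rw [spectralProjection, dif_pos h]

end SpectralTail

/-! ### Existence of the wave operators and passage to the limit -/

section WaveOperators

variable {H₀ : H →ₗ.[ℂ] H} {V : ℝ → H₀.domain →ₗ[ℂ] H} {U : ℝ → ℝ → H →L[ℂ] H}

/-- A family of linear isometries that converges strongly on a set with dense span converges
strongly. -/
theorem exists_tendsto_of_dense_span {ι : Type*} {l : Filter ι} [l.NeBot]
    [l.IsCountablyGenerated] {f : ι → H →L[ℂ] H} (hf : ∀ i x, ‖f i x‖ = ‖x‖) {D : Set H}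
    (hD : Dense (Submodule.span ℂ D : Set H))
    (h : ∀ x ∈ D, ∃ y, Tendsto (fun i => f i x) l (𝓝 y)) :
    ∃ Ω : H →L[ℂ] H, (∀ x, Tendsto (fun i => f i x) l (𝓝 (Ω x))) ∧ ∀ x, ‖Ω x‖ = ‖x‖ := by
  have hspan : ∀ x ∈ Submodule.span ℂ D, ∃ y, Tendsto (fun i => f i x) l (𝓝 y) := by
    intro x hx
    induction hx using Submodule.span_induction with
    | mem x hx => exact h x hx
    | zero => exact ⟨0, by simp⟩
    | add x y _ _ h1 h2 =>
      obtain ⟨u, hu⟩ := h1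
      obtain ⟨v, hv⟩ := h2
      exact ⟨u + v, by simpa using hu.add hv⟩
    | smul c x _ h1 =>
      obtain ⟨u, hu⟩ := h1
      exact ⟨c • u, by simpa using hu.const_smul c⟩
  have hall : ∀ x, ∃ y, Tendsto (fun i => f i x) l (𝓝 y) := by
    intro x
    refine cauchy_map_iff_exists_tendsto.1 ?_
    rw [cauchy_map_iff]
    refine ⟨inferInstance, ?_⟩
    rw [Metric.uniformity_basis_dist.tendsto_right_iff]
    intro ε hε
    obtain ⟨w, hwd, hw⟩ := Metric.dense_iff.1 hD x (ε / 3) (by positivity)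
    rw [Metric.mem_ball, dist_comm, dist_eq_norm] at hwd
    have hc := (cauchy_map_iff.1 (cauchy_map_iff_exists_tendsto.2 (hspan w hw))).2
    rw [Metric.uniformity_basis_dist.tendsto_right_iff] at hc
    filter_upwards [hc (ε / 3) (by positivity)] with p hp
    rw [dist_eq_norm] at hp ⊢
    have h1 : f p.1 x - f p.2 x = f p.1 (x - w) + (f p.1 w - f p.2 w) - f p.2 (x - w) := by
      simp only [map_sub]
      abel
    have h2 := norm_sub_le (f p.1 (x - w) + (f p.1 w - f p.2 w)) (f p.2 (x - w))
    have h3 := norm_add_le (f p.1 (x - w)) (f p.1 w - f p.2 w)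
    rw [hf] at h2 h3
    rw [h1]
    linarith
  choose g hg using hall
  refine ⟨continuousLinearMapOfTendsto f (tendsto_pi_nhds.2 hg), hg, fun x => ?_⟩
  exact tendsto_nhds_unique (hg x).norm (by simp_rw [hf]; exact tendsto_const_nhds)

/-- The integral of `k ≥ 0` between `a` and `b` is the distance between two values of its primitive,
so convergence of the primitive along `l` makes `f` Cauchy. -/
theorem exists_tendsto_of_norm_sub_le_integral {l : Filter ℝ} [l.NeBot] {f : ℝ → H} {k : ℝ → ℝ}
    (hk : Integrable k) (hk0 : ∀ t, 0 ≤ k t)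
    (hl : ∃ c, Tendsto (fun t => ∫ r in (0 : ℝ)..t, k r) l (𝓝 c))
    (hf : ∀ a b, ‖f b - f a‖ ≤ ∫ t in uIoc a b, k t) : ∃ y, Tendsto f l (𝓝 y) := by
  refine cauchy_map_iff_exists_tendsto.1 ?_
  have hc := cauchy_map_iff.1 (cauchy_map_iff_exists_tendsto.2 hl)
  rw [cauchy_map_iff]
  refine ⟨hc.1, ?_⟩
  rw [Metric.uniformity_basis_dist.tendsto_right_iff] at hc ⊢
  intro ε hε
  filter_upwards [hc.2 ε hε] with p hp
  rw [dist_comm, dist_eq_norm] at hp ⊢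
  refine lt_of_le_of_lt (hf _ _) ?_
  rw [intervalIntegral.integral_interval_sub_left hk.intervalIntegrable hk.intervalIntegrable,
    Real.norm_eq_abs, intervalIntegral.abs_integral_eq_abs_integral_uIoc,
    abs_of_nonneg (setIntegral_nonneg measurableSet_uIoc fun t _ => hk0 t)] at hp
  exact hp

/-- The part of the theorem for one of the signs, where `l` is `atTop` or `atBot` and `J` is the
corresponding half-line. -/
theorem exists_waveOperator (hA : IsSelfAdjoint H₀) (hp : IsNonneg H₀)
    (hsa : ∀ t, IsSelfAdjoint (hamiltonian H₀ V t)) (hKato : UniformlyKatoBounded H₀ V)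
    (hV : HasBoundedTimeDeriv V) (hU : IsUnitaryPropagator U) (hUV : IsGeneratedBy H₀ V U)
    {D₀ : Set H} (hD₀ : Dense (Submodule.span ℂ D₀ : Set H))
    (hdecay : ∀ x ∈ D₀, ∃ h : ℝ → ℝ, Integrable h ∧ ∀ t : ℝ,
      ∃ hx : expGroup H₀ t x ∈ H₀.domain,
        ‖V t ⟨expGroup H₀ t x, hx⟩‖ ≤ h t / (1 + |t|) ∧
        ‖timeDeriv V t ⟨expGroup H₀ t x, hx⟩‖ ≤ h t)
    {l : Filter ℝ} [l.NeBot] [l.IsCountablyGenerated] {J : Set ℝ}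
    (hl : ∀ k : ℝ → ℝ, Integrable k → ∃ c, Tendsto (fun t => ∫ r in (0 : ℝ)..t, k r) l (𝓝 c))
    (hJ : ∀ t ∈ J, ∀ᶠ T in l, t ∈ uIcc 0 T) :
    ∃ Ω : H →L[ℂ] H, IsWaveOperator H₀ U l Ω ∧
      closure (Submodule.span ℂ (Ω '' D₀) : Set H) = Set.range Ω ∧
      (∀ x ∈ D₀, KineticEnergyBounded H₀ U J (Ω x)) ∧
      ∀ y ∈ Set.range Ω, HighEnergyUniformlySmall H₀ U J y := by
  have hW := isUnitaryGroupOf_expGroup hA hp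
  have hlim : ∀ x ∈ D₀, ∃ y, Tendsto (fun t => (U 0 t * expGroup H₀ t) x) l (𝓝 y) := by
    intro x hx
    obtain ⟨h, hh, hdec⟩ := hdecay x hx
    choose hm h1 h2 using hdec
    have hk := integrable_div_one_add_abs hh
    exact exists_tendsto_of_norm_sub_le_integral hk (fun t => (norm_nonneg _).trans (h1 t))
      (hl _ hk) (norm_sub_le_integral_of_decay hA hp hsa hU hUV hk fun t => ⟨hm t, h1 t⟩)
  obtain ⟨Ω, hΩ, hΩn⟩ := exists_tendsto_of_dense_span (f := fun t => U 0 t * expGroup H₀ t)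
    (fun t x => (hU.norm_apply 0 t _).trans (hW.norm_apply t x)) hD₀ hlim
  -- At fixed `t`, the evolutions matched to the free one at time `T` converge to the evolution of
  -- `Ω x`. All bounds uniform in `T` are transferred through this limit.
  have hΩU : ∀ t x, Tendsto (fun T => U t T (expGroup H₀ T x)) l (𝓝 (U t 0 (Ω x))) := by
    intro t x
    have h1 := ((U t 0).continuous.tendsto (Ω x)).comp (hΩ x)
    refine h1.congr fun T => ?_
    exact hU.apply_apply t 0 T _
  have hkin : ∀ x ∈ D₀, ∃ C : ℝ, ∀ t ∈ J, ∀ᶠ T in l,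
      ∃ hm : U t T (expGroup H₀ T x) ∈ H₀.domain,
        (⟪U t T (expGroup H₀ T x), H₀ ⟨_, hm⟩⟫_ℂ).re ≤ C := by
    intro x hx
    obtain ⟨h, hh, hdec⟩ := hdecay x hx
    obtain ⟨C, hC⟩ := exists_kinetic_energy_bound hA hp hsa hKato hV hU hUV hh hdec
    exact ⟨C, fun t ht => (hJ t ht).mono fun T hT => hC T t hT⟩
  have hiso : Isometry Ω := AddMonoidHomClass.isometry_of_norm Ω hΩn
  refine ⟨Ω, fun x => ?_, ?_, fun x hx => ?_, ?_⟩
  · simp_rw [hU.adjoint_eq]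
    exact hΩ x
  · have h1 : (Submodule.span ℂ (Ω '' D₀) : Set H) = Ω '' (Submodule.span ℂ D₀ : Set H) := by
      have := Submodule.map_span Ω.toLinearMap D₀
      exact (congrArg (fun S : Submodule ℂ H => (S : Set H)) this).symm
    rw [h1]
    refine subset_antisymm ?_ ?_
    · exact closure_minimal (image_subset_range _ _) hiso.isClosedEmbedding.isClosed_range
    · have := image_closure_subset_closure_image Ω.continuous (s := (Submodule.span ℂ D₀ : Set H))
      rwa [hD₀.closure_eq, image_univ] at this
  · obtain ⟨C, hC⟩ := hkin x hx
    have hB := sqrtOp_spec hA hp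
    refine ⟨√C, fun t ht => ?_⟩
    refine exists_norm_apply_le_of_tendsto hB.selfAdjoint (hΩU t x) ((hC t ht).mono ?_)
    rintro T ⟨hm, hT⟩
    obtain ⟨hm', hB'⟩ := hB.norm_sq ⟨_, hm⟩
    refine ⟨hm', Real.le_sqrt_of_sq_le ?_⟩
    rw [hB']
    exact hT
  · obtain ⟨E, hE, hEF⟩ := exists_spectralProjection_eq hA hp
    -- Asking for every `c ≥ c₀`, not just one cutoff, lets the cutoffs of two summands be replaced
    -- by their maximum.
    have key : ∀ x, ∀ ε > (0 : ℝ), ∃ c₀ : ℝ, ∀ c ≥ c₀, ∀ t ∈ J,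
        ‖E.proj (Ioi c) (U t 0 (Ω x))‖ ≤ ε := by
      have hspan : ∀ x ∈ Submodule.span ℂ D₀, ∀ ε > (0 : ℝ), ∃ c₀ : ℝ, ∀ c ≥ c₀, ∀ t ∈ J,
          ‖E.proj (Ioi c) (U t 0 (Ω x))‖ ≤ ε := by
        intro x hx
        induction hx using Submodule.span_induction with
        | mem x hx =>
          intro ε hε
          obtain ⟨C, hC⟩ := hkin x hx
          -- Chebyshev gives `c‖F‖² ≤ C`, so `c ≥ C/ε²` suffices; the `1` keeps `c` positive.
          refine ⟨max 1 (C / ε ^ 2), fun c hc t ht => ?_⟩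
          have hc0 : 0 < c := lt_of_lt_of_le one_pos ((le_max_left _ _).trans hc)
          have h1 : Tendsto (fun T => c * ‖E.proj (Ioi c) (U t T (expGroup H₀ T x))‖ ^ 2) l
              (𝓝 (c * ‖E.proj (Ioi c) (U t 0 (Ω x))‖ ^ 2)) :=
            ((((E.proj (Ioi c)).continuous.tendsto _).comp (hΩU t x)).norm.pow 2).const_mul c
          have h2 : c * ‖E.proj (Ioi c) (U t 0 (Ω x))‖ ^ 2 ≤ C := by
            refine le_of_tendsto h1 ((hC t ht).mono ?_)
            rintro T ⟨hm, hT⟩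
            exact (hE.mul_norm_sq_le hp ⟨_, hm⟩ hc0).trans hT
          have h3 : C ≤ c * ε ^ 2 := by
            rw [← div_le_iff₀ (by positivity)]
            exact (le_max_right _ _).trans hc
          have h4 := le_of_mul_le_mul_left (h2.trans h3) hc0
          exact (pow_le_pow_iff_left₀ (norm_nonneg _) hε.le two_ne_zero).1 h4
        | zero =>
          intro ε hε
          exact ⟨0, fun c _ t _ => by simpa using hε.le⟩
        | add x y _ _ h1 h2 =>
          intro ε hε
          obtain ⟨c₁, hc₁⟩ := h1 (ε / 2) (by positivity)
          obtain ⟨c₂, hc₂⟩ := h2 (ε / 2) (by positivity)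
          refine ⟨max c₁ c₂, fun c hc t ht => ?_⟩
          simp only [map_add]
          have := hc₁ c ((le_max_left _ _).trans hc) t ht
          have := hc₂ c ((le_max_right _ _).trans hc) t ht
          exact (norm_add_le _ _).trans (by linarith)
        | smul a x _ h1 =>
          intro ε hε
          obtain ⟨c₀, hc₀⟩ := h1 (ε / (‖a‖ + 1)) (by positivity)
          refine ⟨c₀, fun c hc t ht => ?_⟩
          simp only [map_smul, norm_smul]
          have := hc₀ c hc t ht
          rw [le_div_iff₀ (by positivity)] at this
          nlinarith [norm_nonneg (E.proj (Ioi c) (U t 0 (Ω x)))]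
      intro x ε hε
      obtain ⟨w, hwd, hw⟩ := Metric.dense_iff.1 hD₀ x (ε / 2) (by positivity)
      rw [Metric.mem_ball, dist_comm, dist_eq_norm] at hwd
      obtain ⟨c₀, hc₀⟩ := hspan w hw (ε / 2) (by positivity)
      refine ⟨c₀, fun c hc t ht => ?_⟩
      -- The error `x - w` costs at most its own norm, uniformly in `t`, since `Ω` and `U t 0` are
      -- isometric and the projection is a contraction.
      have h1 : E.proj (Ioi c) (U t 0 (Ω x)) = E.proj (Ioi c) (U t 0 (Ω w))
          + E.proj (Ioi c) (U t 0 (Ω (x - w))) := by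
        simp only [map_sub]
        abel
      have h2 := E.norm_proj_apply_le (measurableSet_Ioi (a := c)) (U t 0 (Ω (x - w)))
      rw [hU.norm_apply, hΩn] at h2
      have h3 := hc₀ c hc t ht
      rw [h1]
      exact (norm_add_le _ _).trans (by linarith)
    rintro _ ⟨x, rfl⟩ ε hε
    obtain ⟨c₀, hc₀⟩ := key x (ε / 2) (by positivity)
    refine ⟨c₀, ε / 2, by linarith, fun t ht => ?_⟩
    rw [hEF]
    exact hc₀ c₀ le_rfl t ht

end WaveOperators

end TimeDependentScattering

end

/-! ### The theorem for the two time directions -/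

open TimeDependentScattering in
theorem proposition2p1 {H : Type*} [NormedAddCommGroup H] [InnerProductSpace ℂ H] [CompleteSpace H]
    (H₀ : H →ₗ.[ℂ] H) (hH₀ : IsSelfAdjoint H₀) (hpos : IsNonneg H₀)
    (V : ℝ → H₀.domain →ₗ[ℂ] H)
    (hsa : ∀ t, IsSelfAdjoint (hamiltonian H₀ V t))
    (hKato : UniformlyKatoBounded H₀ V)
    (hderiv : HasBoundedTimeDeriv V)
    (U : ℝ → ℝ → H →L[ℂ] H) (hU : IsUnitaryPropagator U) (hUV : IsGeneratedBy H₀ V U)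
    (D₀ : Set H) (hD₀ : Dense (Submodule.span ℂ D₀ : Set H))
    (hdecay : ∀ x ∈ D₀, ∃ h : ℝ → ℝ, Integrable h ∧ ∀ t : ℝ,
      ∃ hx : expGroup H₀ t x ∈ H₀.domain,
        ‖V t ⟨expGroup H₀ t x, hx⟩‖ ≤ h t / (1 + |t|) ∧
        ‖timeDeriv V t ⟨expGroup H₀ t x, hx⟩‖ ≤ h t) :
    (∃ Ωp : H →L[ℂ] H, IsWaveOperator H₀ U atTop Ωp ∧
      closure (Submodule.span ℂ (Ωp '' D₀) : Set H) = Set.range Ωp ∧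
      (∀ x ∈ D₀, KineticEnergyBounded H₀ U (Ici 0) (Ωp x)) ∧
      ∀ y ∈ Set.range Ωp, HighEnergyUniformlySmall H₀ U (Ici 0) y) ∧
    (∃ Ωm : H →L[ℂ] H, IsWaveOperator H₀ U atBot Ωm ∧
      closure (Submodule.span ℂ (Ωm '' D₀) : Set H) = Set.range Ωm ∧
      (∀ x ∈ D₀, KineticEnergyBounded H₀ U (Iic 0) (Ωm x)) ∧
      ∀ y ∈ Set.range Ωm, HighEnergyUniformlySmall H₀ U (Iic 0) y) := by
  refine ⟨exists_waveOperator hH₀ hpos hsa hKato hderiv hU hUV hD₀ hdecay (fun k hk => ?_)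
    fun t ht => ?_, exists_waveOperator hH₀ hpos hsa hKato hderiv hU hUV hD₀ hdecay
    (fun k hk => ?_) fun t ht => ?_⟩
  · exact ⟨_, intervalIntegral_tendsto_integral_Ioi 0 hk.integrableOn tendsto_id⟩
  · filter_upwards [eventually_ge_atTop t] with T hT
    exact mem_uIcc.2 (Or.inl ⟨ht, hT⟩)
  · have := (intervalIntegral_tendsto_integral_Iic 0 hk.integrableOn tendsto_id).neg
    refine ⟨_, this.congr fun t => ?_⟩
    rw [intervalIntegral.integral_symm]
    simp
  · filter_upwards [eventually_le_atBot t] with T hT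
    exact mem_uIcc.2 (Or.inr ⟨hT, ht⟩)
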